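/- **Setting.** Let $d\ge 1$, let $\Omega\subset\mathbb R^d$ be a bounded open set, $u_1,\dots,u_N$ input data, and $g[u]$ a functional of $u$ such that each $g[u_k]$ is continuous and bounded on $\Omega\times\Omega$, and $Z:=\frac1N\sum_k\int_\Omega\int_\Omega|g[u_k](x,y)|\,dx\,dy>0$. Assume that for each $r>0$ such that the sphere $\{|y|=r\}$ meets $\Omega$, the surface measure of $\{\xi\in S^{d-1}: r\xi\notin\Omega,\ s\xi\in\Omega\}$ tends to $0$ as $s\downarrow r$ or as $s\uparrow r$ (this holds, for instance, for intervals and for sets star-shaped about the origin). Put $$R_\phi[u](x)=\int_\Omega\phi(|y|)\,g[u](x,y)\,dy,\qquad \langle\!\langle\phi,\psi\rangle\!\rangle=\frac1N\sum_{k=1}^N\langle R_\phi[u_k],R_\psi[u_k]\rangle_{L^2(\Omega)} ,$$ let $\rho$ be the probability measure $\rho(dr)=\frac1{ZN}\sum_k\int_\Omega\int_\Omega\delta(|y|-r)\,|g[u_k](x,y)|\,dx\,dy$, with density $\rho(r)=\frac1{ZN}\sum_k r^{d-1}\int_{|\xi|=1}\mathbf 1_\Omega(r\xi)\int_\Omega|g[u_k](x,r\xi)|\,dx\,d\xi$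 for $r>0$, and let $$G(r,s)=\frac1N\sum_{k=1}^N r^{d-1}s^{d-1}\int_{|\eta|=1}\int_{|\xi|=1}\mathbf 1_\Omega(r\xi)\mathbf 1_\Omega(s\eta)\int_\Omega g[u_k](x,r\xi)\,g[u_k](x,s\eta)\,dx\,d\xi\,d\eta ,\qquad \overline G(r,s)=\frac{G(r,s)}{\rho(r)\rho(s)}$$ for $r,s>0$ with $\rho(r),\rho(s)>0$, and $\overline G(r,s)=0$ otherwise. Then $\rho$ is a probability measure with the stated density, $R_\phi[u_k]$ is well defined (the integral over $y$ converges absolutely for a.e. $x\in\Omega$) and belongs to $L^2(\Omega)$ for $\phi\in L^2(\rho)$, and $\overline G$ is positive semi-definite. The integral operator $\mathcal L_{\overline G}\phi(r)=\int\phi(s)\overline G(r,s)\,\rho(ds)$ is a well-defined bounded operator on $L^2(\rho)$ with a positive square root $\mathcal L_{\overline G}^{1/2}$; let $\mathcal L_{\overline G}^{-1/2}$ be the inverse of $\mathcal L_{\overline G}^{1/2}$ on its range with values in $(\ker\mathcal L_{\overline G}^{1/2})^\perp$. Let $H_G$ be the reproducing kernel Hilbert space with kernel $\overline G$. **Lemma.**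 (a) The functions in $H_G$ belong to $L^2(\rho)$; sending a function to its class is a bounded injection of $H_G$ into $L^2(\rho)$, and, with $H_G$ identified with its image, $H_G=\mathcal L_{\overline G}^{1/2}(L^2(\rho))$ and $\langle\phi,\psi\rangle_{H_G}=\langle\mathcal L_{\overline G}^{-1/2}\phi,\mathcal L_{\overline G}^{-1/2}\psi\rangle_{L^2(\rho)}$ for all $\phi,\psi\in H_G$. (b) $L^2(\rho)$ has an orthonormal basis $\{\psi_i\}_i\cup\{\psi^0_j\}_j$ of eigenfunctions of $\mathcal L_{\overline G}$, where the $\psi_i$ (finitely many, or a sequence) have positive eigenvalues $\lambda_i$ in decreasing order and the $\psi^0_j$ (if any) have eigenvalue $0$. For each such basis, $\lambda_i\to0$ if there are infinitely many $\lambda_i$, and for each $\phi=\sum_ic_i\psi_i+\sum_jc^0_j\psi^0_j\in L^2(\rho)$, $$\langle\!\langle\phi,\phi\rangle\!\rangle=\sum_i\lambda_ic_i^2,\qquad\|\phi\|_{L^2(\rho)}^2=\sum_ic_i^2+\sum_j(c_j^0)^2 .$$ If $\phi\in H_G$, then moreover all $c^0_j$ are $0$ and $\|\phi\|_{H_G}^2=\sum_i\lambda_i^{-1}c_i^2$.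 (c) For all $\phi\in L^2(\rho)$ and $\psi\in H_G$, the functions $\mathcal L_{\overline G}\phi$ and $\mathcal L_{\overline G}^2\phi$ lie in $H_G$ and $$\langle\phi,\psi\rangle_{L^2(\rho)}=\langle\mathcal L_{\overline G}\phi,\psi\rangle_{H_G},\qquad\langle\!\langle\phi,\psi\rangle\!\rangle=\langle\mathcal L_{\overline G}^2\phi,\psi\rangle_{H_G}.$$ -/

import Mathlib

open MeasureTheory Filter Topology
open scoped InnerProductSpace

noncomputable section

namespace SIDA

/-- The space `ℝ^d` with its Euclidean norm. -/
abbrev Sp (d : ℕ) : Type := EuclideanSpace ℝ (Fin d)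

/-- The surface measure on the unit sphere of `ℝ^d` (counting measure on `{-1, 1}` if `d = 1`). -/
abbrev sphereMeasure (d : ℕ) : Measure (Metric.sphere (0 : Sp d) 1) :=
  (volume : Measure (Sp d)).toSphere

/-- For every sphere `|y| = r` that meets `Ω`, the measure of the set of directions `ξ` with
`r ξ ∉ Ω` and `s ξ ∈ Ω` tends to zero as `s` decreases to `r`, or as `s` increases to `r`.
This holds for intervals, for sets that are star-shaped about the origin, and whenever no sphere
about the origin that meets `Ω` shares a set of positive surface measure with `∂Ω`. -/
def RadiallyRegular {d : ℕ} (Ω : Set (Sp d)) : Prop :=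
  ∀ r : ℝ, 0 < r → (∃ y ∈ Ω, ‖y‖ = r) →
    Tendsto (fun s : ℝ => sphereMeasure d {ξ | r • (ξ : Sp d) ∉ Ω ∧ s • (ξ : Sp d) ∈ Ω})
        (𝓝[>] r) (𝓝 0) ∨
      Tendsto (fun s : ℝ => sphereMeasure d {ξ | r • (ξ : Sp d) ∉ Ω ∧ s • (ξ : Sp d) ∈ Ω})
        (𝓝[<] r) (𝓝 0)

variable {d N : ℕ} {𝕏 : Type*}

/-- The operator `R_φ[v](x) = ∫_Ω φ(|y|) g[v](x, y) dy`. -/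
def opR (Ω : Set (Sp d)) (g : 𝕏 → Sp d → Sp d → ℝ) (φ : ℝ → ℝ) (v : 𝕏) (x : Sp d) : ℝ :=
  ∫ y in Ω, φ ‖y‖ * g v x y

/-- The bilinear form `⟪φ, ψ⟫ = (1/N) ∑ₖ ⟨R_φ[uₖ], R_ψ[uₖ]⟩_{L²(Ω)}`. -/
def bilin (Ω : Set (Sp d)) (g : 𝕏 → Sp d → Sp d → ℝ) (u : Fin N → 𝕏) (φ ψ : ℝ → ℝ) : ℝ :=
  (1 / (N : ℝ)) * ∑ k, ∫ x in Ω, opR Ω g φ (u k) x * opR Ω g ψ (u k) x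

/-- The normalizing constant `Z = (1/N) ∑ₖ ∫_Ω ∫_Ω |g[uₖ](x, y)| dx dy`. -/
def normConst (Ω : Set (Sp d)) (g : 𝕏 → Sp d → Sp d → ℝ) (u : Fin N → 𝕏) : ℝ :=
  (1 / (N : ℝ)) * ∑ k, ∫ y in Ω, ∫ x in Ω, |g (u k) x y|

/-- The exploration measure
`ρ(dr) = (1/(Z N)) ∑ₖ ∫_Ω ∫_Ω δ(|y| - r) |g[uₖ](x, y)| dx dy`: the normalized sum of the images
under `(x, y) ↦ |y|` of the measures `|g[uₖ](x, y)| dx dy` on `Ω × Ω`. -/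
def rho (Ω : Set (Sp d)) (g : 𝕏 → Sp d → Sp d → ℝ) (u : Fin N → 𝕏) : Measure ℝ :=
  ENNReal.ofReal (1 / (normConst Ω g u * N)) •
    ∑ k, Measure.map (fun p : Sp d × Sp d => ‖p.2‖)
      ((((volume : Measure (Sp d)).restrict Ω).prod (volume.restrict Ω)).withDensity
        fun p => ENNReal.ofReal |g (u k) p.1 p.2|)

/-- The density of the exploration measure, in polar coordinates:
`ρ(r) = (1/(Z N)) ∑ₖ r^{d-1} ∫_{|ξ| = 1} 1_Ω(r ξ) ∫_Ω |g[uₖ](x, r ξ)| dx dξ` for `r > 0`,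
and zero for `r ≤ 0`. -/
def rhoDensity (Ω : Set (Sp d)) (g : 𝕏 → Sp d → Sp d → ℝ) (u : Fin N → 𝕏) (r : ℝ) : ℝ :=
  if 0 < r then
    (1 / (normConst Ω g u * N)) * ∑ k, r ^ (d - 1) *
      ∫ ξ, (∫ x in Ω, Ω.indicator (fun y => |g (u k) x y|) (r • (ξ : Sp d))) ∂(sphereMeasure d)
  else 0

/-- The integral kernel in polar coordinates,
`G(r, s) = (1/N) ∑ₖ r^{d-1} s^{d-1} ∫_{|η|=1} ∫_{|ξ|=1} 1_Ω(rξ) 1_Ω(sη)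
  ∫_Ω g[uₖ](x, r ξ) g[uₖ](x, s η) dx dξ dη` for `r, s > 0`, and zero otherwise. -/
def kerG (Ω : Set (Sp d)) (g : 𝕏 → Sp d → Sp d → ℝ) (u : Fin N → 𝕏) (r s : ℝ) : ℝ :=
  if 0 < r ∧ 0 < s then
    (1 / (N : ℝ)) * ∑ k, r ^ (d - 1) * s ^ (d - 1) *
      ∫ η, (∫ ξ, (∫ x in Ω, Ω.indicator (g (u k) x) (r • (ξ : Sp d)) *
        Ω.indicator (g (u k) x) (s • (η : Sp d))) ∂(sphereMeasure d)) ∂(sphereMeasure d)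
  else 0

/-- The reweighted kernel `Ḡ(r, s) = G(r, s) / (ρ(r) ρ(s))` where `ρ(r), ρ(s) > 0`, and zero
at all other points (where `G` vanishes as well). -/
def kerGbar (Ω : Set (Sp d)) (g : 𝕏 → Sp d → Sp d → ℝ) (u : Fin N → 𝕏) (r s : ℝ) : ℝ :=
  if 0 < rhoDensity Ω g u r ∧ 0 < rhoDensity Ω g u s then
    kerG Ω g u r s / (rhoDensity Ω g u r * rhoDensity Ω g u s)
  else 0

/-- The scalar kernel `Ḡ` in the form of an operator-valued kernel on the one-dimensional
space `ℝ`. -/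
def kerMatrix (Ω : Set (Sp d)) (g : 𝕏 → Sp d → Sp d → ℝ) (u : Fin N → 𝕏) :
    Matrix ℝ ℝ (ℝ →L[ℝ] ℝ) :=
  Matrix.of fun r s => kerGbar Ω g u r s • ContinuousLinearMap.id ℝ ℝ

/-- `L` is the integral operator `(L φ)(r) = ∫ φ(s) K(r, s) μ(ds)` on `L²(μ)`. -/
def IsIntegralOperator (μ : Measure ℝ) (K : ℝ → ℝ → ℝ) (L : Lp ℝ 2 μ →L[ℝ] Lp ℝ 2 μ) : Prop :=
  ∀ φ : Lp ℝ 2 μ, ∀ᵐ r ∂μ,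
    Integrable (fun s => φ s * K r s) μ ∧ L φ r = ∫ s, φ s * K r s ∂μ

section Operators

variable {E : Type*} [NormedAddCommGroup E] [InnerProductSpace ℝ E]

/-- `S` is the positive square root of `L`. -/
def IsPosSqrt (S L : E →L[ℝ] E) : Prop :=
  S.IsPositive ∧ S ∘L S = L

open Classical in
/-- The inverse of `S` on its range: for `y` in the range of `S`, the unique preimage of `y` in
the orthogonal complement of the kernel of `S`. -/
def pinv (S : E →L[ℝ] E) (y : E) : E :=
  if h : ∃ x, x ∈ (S.ker)ᗮ ∧ S x = y then h.choose else 0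

theorem pinv_spec [CompleteSpace E] (S : E →L[ℝ] E) {y : E} (hy : ∃ x, S x = y) :
    pinv S y ∈ (S.ker)ᗮ ∧ S (pinv S y) = y := by
  have h : ∃ x, x ∈ (S.ker)ᗮ ∧ S x = y := by
    obtain ⟨x, rfl⟩ := hy
    have : CompleteSpace (S.ker) := (ContinuousLinearMap.isClosed_ker S).completeSpace_coe
    obtain ⟨a, ha, b, hb, rfl⟩ := (S.ker).exists_add_mem_mem_orthogonal x
    have ha' : S a = 0 := ha
    exact ⟨b, hb, by rw [map_add, ha', zero_add]⟩
  unfold pinv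
  rw [dif_pos h]
  exact h.choose_spec

theorem eq_pinv (S : E →L[ℝ] E) {x y : E} (hx : x ∈ (S.ker)ᗮ) (hxy : S x = y) :
    pinv S y = x := by
  have h : ∃ x, x ∈ (S.ker)ᗮ ∧ S x = y := ⟨x, hx, hxy⟩
  unfold pinv
  rw [dif_pos h]
  have h1 : h.choose - x ∈ S.ker := by
    change S (h.choose - x) = 0
    rw [map_sub, h.choose_spec.2, hxy, sub_self]
  have h2 : h.choose - x ∈ (S.ker)ᗮ := Submodule.sub_mem _ h.choose_spec.1 hx
  have h3 := (Submodule.mem_orthogonal _ _).1 h2 _ h1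
  exact sub_eq_zero.1 (inner_self_eq_zero.1 h3)

/-- The indices `0, 1, 2, …` below `n`: finitely many, or all of `ℕ` when `n = ⊤`. -/
abbrev Idx (n : ℕ∞) : Type := {i : ℕ // (i : ℕ∞) < n}

/-- An orthonormal basis of `E` that consists of eigenvectors of `L`: eigenvectors `ψ i` with
positive eigenvalues `eig i` in decreasing order (with multiplicity), indexed by the numbers
below `n`, and eigenvectors with eigenvalue zero, indexed by `J`. -/
structure EigenSystem (L : E →L[ℝ] E) (n : ℕ∞) (J : Type) where
  basis : HilbertBasis (Idx n ⊕ J) ℝ E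
  eig : Idx n → ℝ
  eig_pos : ∀ i, 0 < eig i
  eig_antitone : Antitone eig
  apply_inl : ∀ i, L (basis (Sum.inl i)) = eig i • basis (Sum.inl i)
  apply_inr : ∀ j, L (basis (Sum.inr j)) = 0

end Operators

end SIDA

end

/-!
Everything rests on two factorizations of the integral operator `L` with kernel `Ḡ`.

* Let `Φₖ(r) ∈ L²(Ω)` be the integral of `g[uₖ](x, ·)` over the sphere of radius `r`, divided by
  the density of `ρ` relative to `r^{d-1} dr`. Then `Ḡ(r, s) = (1/N) ∑ₖ ⟪Φₖ(r), Φₖ(s)⟫`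
  (`kerGbar_eq`), so `Ḡ` is positive semi-definite, and `∫ ‖Φₖ(r)‖² ρ(dr)` is finite because
  `‖Φₖ(r)‖²` is at most a constant multiple of `r^{d-1} / ρ(r)` and vanishes for large `r`
  (`integrable_norm_feature_sq`). Hence `f ↦ ⟪Φₖ(·), f⟫` is a Hilbert-Schmidt operator
  `Bₖ : L²(Ω) → L²(ρ)`, and `L = (1/N) ∑ₖ Bₖ Bₖ†` is compact and positive. Polar coordinates and
  Fubini's theorem give `Bₖ† φ = R_φ[uₖ]` (`adjoint_ae_eq_opR`), whence the bilinear form of the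
  problem is `(φ, ψ) ↦ ⟪φ, L ψ⟫` (`bilin_eq_inner`).
* If `H` has reproducing kernel `Ḡ`, then `f ↦ ⟪K_r, f⟫ = f(r)` is an operator of the same kind
  `ι : H → L²(ρ)`, and `ι ι†` has the same integral kernel, so `ι ι† = L`
  (`comp_adjoint_eq_integralOp`).

The spectral theorem for compact self-adjoint operators gives the eigenbases, and the square root
`S` of `L` is diagonal in one of them. From `ι ι† = L = S S†` it follows that `ι† φ ↦ S φ` extends
to an isometry of `(ker ι)ᗮ` onto `(ker S)ᗮ` (`exists_mem_orthogonal_ker_of_comp_adjoint_eq`).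
Together with the injectivity of `ι` this describes the range and the inner product of `H`.
Injectivity also shows that the vectors `λᵢ^{-1/2} ι† ψᵢ` form a Hilbert basis of `H`.

Radial regularity of `Ω` enters only in the injectivity of `ι` (`eq_zero_of_ae_eq_zero`): it makes
`r ↦ Φₖ(r)`, hence `r ↦ K_r`, continuous from one side at every point of positive density, so a
function of `H` that vanishes almost everywhere vanishes at these points; at the other points `K_r`
is zero.
-/

noncomputable section

namespace SIDA

/-! ### Compact operators and their eigenvectors -/

section Compact

variable {E F : Type*} [NormedAddCommGroup E] [InnerProductSpace ℝ E]
  [NormedAddCommGroup F] [InnerProductSpace ℝ F] [CompleteSpace F]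

/-- A Hilbert-Schmidt operator is compact, being the limit in norm of its finite sections. -/
theorem isCompactOperator_of_summable_norm_sq {ι : Type*} (T : E →L[ℝ] F)
    (b : HilbertBasis ι ℝ E) (h : Summable fun i => ‖T (b i)‖ ^ 2) : IsCompactOperator T := by
  classical
  let P : Finset ι → E →L[ℝ] F := fun s => ∑ i ∈ s, (innerSL ℝ (b i)).smulRight (T (b i))
  have hP : ∀ s, IsCompactOperator (P s) := by
    intro s
    refine (compactOperator (RingHom.id ℝ) E F).sum_mem fun i _ => ?_
    change IsCompactOperator _
    have : IsCompactOperator (innerSL ℝ (b i)) :=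
      isCompactOperator_id.comp_clm (innerSL ℝ (b i))
    exact this.clm_comp ((ContinuousLinearMap.id ℝ ℝ).smulRight (T (b i)))
  refine isCompactOperator_of_tendsto (l := (atTop : Filter (Finset ι))) (F := P) ?_
    (Eventually.of_forall hP)
  rw [Metric.tendsto_atTop]
  intro ε hε
  have hε2 : 0 < (ε / 2) ^ 2 := by positivity
  obtain ⟨s, hs⟩ := (summable_iff_vanishing_norm.1 h) _ hε2
  refine ⟨s, fun t hst => ?_⟩
  rw [dist_eq_norm]
  refine lt_of_le_of_lt (ContinuousLinearMap.opNorm_le_bound _ (half_pos hε).le fun x => ?_)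
    (half_lt_self hε)
  -- `T x` is the limit of `P u x`, and `P u - P t` is controlled by Cauchy-Schwarz
  have hx : Tendsto (fun u => P u x) atTop (𝓝 (T x)) := by
    have := ((b.hasSum_repr x).mapL T)
    refine this.congr fun u => ?_
    simp [P, b.repr_apply_apply]
  have hlim : Tendsto (fun u => ‖P t x - P u x‖) atTop (𝓝 ‖(P t - T) x‖) :=
    (tendsto_const_nhds.sub hx).norm
  refine le_of_tendsto hlim ?_
  filter_upwards [eventually_ge_atTop t] with u hu
  have h1 : P t x - P u x = -∑ i ∈ u \ t, ⟪b i, x⟫_ℝ • T (b i) := by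
    have := Finset.sum_sdiff hu (f := fun i => ⟪b i, x⟫_ℝ • T (b i))
    simp only [P, sum_apply, ContinuousLinearMap.smulRight_apply,
      innerSL_apply_apply, ← this]
    abel
  rw [h1, norm_neg]
  have h2 : ‖∑ i ∈ u \ t, ⟪b i, x⟫_ℝ • T (b i)‖ ≤ ∑ i ∈ u \ t, |⟪b i, x⟫_ℝ| * ‖T (b i)‖ :=
    (norm_sum_le _ _).trans_eq (by simp [norm_smul])
  refine h2.trans (abs_le_of_sq_le_sq' ?_ (by positivity)).2
  refine (Finset.sum_mul_sq_le_sq_mul_sq _ _ _).trans ?_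
  rw [mul_pow, mul_comm]
  have h3 : ∑ i ∈ u \ t, ‖T (b i)‖ ^ 2 ≤ (ε / 2) ^ 2 := by
    have := hs (u \ t) (Finset.disjoint_left.2 fun i hi his =>
      (Finset.mem_sdiff.1 hi).2 (hst his))
    exact ((le_abs_self _).trans this.le)
  have h4 : ∑ i ∈ u \ t, |⟪b i, x⟫_ℝ| ^ 2 ≤ ‖x‖ ^ 2 := by
    simpa using b.orthonormal.sum_inner_products_le x (s := u \ t)
  gcongr

/-- A compact self-adjoint operator has a Hilbert basis of eigenvectors, assembled from Hilbert
bases of its eigenspaces. -/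
theorem exists_hilbertBasis_of_isCompactOperator [CompleteSpace E] {L : E →L[ℝ] E}
    (hc : IsCompactOperator L) (hL : L.IsSymmetric) :
    ∃ (I : Set E) (b : HilbertBasis I ℝ E) (a : I → ℝ), ∀ i, L (b i) = a i • b i := by
  classical
  let V : ℝ → Submodule ℝ E := fun μ => Module.End.eigenspace (L : E →ₗ[ℝ] E) μ
  have hV : ∀ μ, ∃ (w : Set (V μ)) (b : HilbertBasis w ℝ (V μ)), ⇑b = ((↑) : w → V μ) := by
    intro μ
    have : IsClosed (V μ : Set E) := by
      have : (V μ : Set E) = ((L - μ • ContinuousLinearMap.id ℝ E).ker : Set E) := by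
        ext x
        simp [V, sub_eq_zero]
      rw [this]
      exact ContinuousLinearMap.isClosed_ker _
    have : CompleteSpace (V μ) := this.completeSpace_coe
    exact exists_hilbertBasis ℝ (V μ)
  choose w b hb using hV
  have horth : OrthogonalFamily ℝ (fun μ => V μ) fun μ => (V μ).subtypeₗᵢ :=
    LinearMap.IsSymmetric.orthogonalFamily_eigenspaces hL
  have hon := horth.orthonormal_sigma_orthonormal (v_family := fun μ => b μ)
    (fun μ => (b μ).orthonormal)
  set v : (Σ μ, w μ) → E := fun a => (V a.1).subtypeₗᵢ (b a.1 a.2) with hv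
  have hbot : (Submodule.span ℝ (Set.range v))ᗮ = ⊥ := by
    rw [eq_bot_iff, ← ContinuousLinearMap.orthogonalComplement_iSup_eigenspaces_eq_bot hc hL]
    intro x hx
    rw [Submodule.mem_orthogonal'] at hx ⊢
    intro y hy
    refine Submodule.iSup_induction V (motive := fun y => ⟪x, y⟫_ℝ = 0) hy ?_ (by simp)
      (fun y z hy hz => by rw [inner_add_right, hy, hz, add_zero])
    intro μ y hy
    have h1 := ((b μ).hasSum_repr ⟨y, hy⟩).mapL ((innerSL ℝ x).comp (V μ).subtypeL)
    have h2 : ∀ i, ((innerSL ℝ x).comp (V μ).subtypeL) ((b μ).repr ⟨y, hy⟩ i • (b μ) i) = 0 := by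
      intro i
      have := hx (v ⟨μ, i⟩) (Submodule.subset_span ⟨_, rfl⟩)
      rw [map_smul]
      exact (congrArg _ this).trans (smul_zero _)
    simp only [h2] at h1
    exact (hasSum_zero.unique h1).symm
  have hon' : Orthonormal ℝ v := hon
  let I : Set E := Set.range v
  have hI : Orthonormal ℝ ((↑) : I → E) := hon'.toSubtypeRange
  have hsp : (Submodule.span ℝ (Set.range ((↑) : I → E)))ᗮ = ⊥ := by
    rwa [Subtype.range_coe]
  have hev : ∀ i : I, ∃ μ : ℝ, L i = μ • (i : E) := by
    rintro ⟨_, ⟨μ, i⟩, rfl⟩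
    exact ⟨μ, Module.End.mem_eigenspace_iff.1 (b μ i).2⟩
  choose a ha using hev
  refine ⟨I, HilbertBasis.mkOfOrthogonalEqBot hI hsp, a, fun i => ?_⟩
  simpa using ha i

/-- Infinitely many orthonormal eigenvectors with eigenvalues bounded away from zero would have
images that are uniformly separated, which compactness forbids. -/
theorem tendsto_eigenvalue_cofinite {I : Type*} {L : E →L[ℝ] E} (hc : IsCompactOperator L)
    {v : I → E} (hv : Orthonormal ℝ v) {a : I → ℝ} (ha : ∀ i, L (v i) = a i • v i) :
    Tendsto a cofinite (𝓝 0) := by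
  rw [Metric.tendsto_nhds]
  intro ε hε
  rw [Filter.eventually_cofinite]
  by_contra hinf
  rw [← Set.Infinite] at hinf
  let f := hinf.natEmbedding
  have hK : IsCompact (closure (L '' Metric.closedBall 0 1)) :=
    hc.isCompact_closure_image_closedBall 1
  have hmem : ∀ n : ℕ, L (v (f n)) ∈ closure (L '' Metric.closedBall 0 1) := fun n =>
    subset_closure ⟨_, by simp [hv.1], rfl⟩
  obtain ⟨y, -, φ, hφ, hy⟩ := hK.tendsto_subseq hmem
  obtain ⟨m, hm⟩ := Metric.cauchySeq_iff.1 hy.cauchySeq ε hε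
  have h1 := hm m le_rfl (m + 1) (Nat.le_succ m)
  have hne : (f (φ m) : I) ≠ f (φ (m + 1)) := fun h =>
    (hφ (Nat.lt_succ_self m)).ne (f.injective (Subtype.ext h))
  have h2 : ε ≤ |a (f (φ m))| := by
    have := (f (φ m)).2
    simpa using this
  have h3 : ‖L (v (f (φ m))) - L (v (f (φ (m + 1))))‖ ^ 2
      = a (f (φ m)) ^ 2 + a (f (φ (m + 1))) ^ 2 := by
    rw [ha, ha, @norm_sub_sq_real, norm_smul, norm_smul, hv.1, hv.1, inner_smul_left,
      inner_smul_right, hv.2 hne]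
    simp
  have h4 : ε ^ 2 ≤ ‖L (v (f (φ m))) - L (v (f (φ (m + 1))))‖ ^ 2 := by
    rw [h3, ← sq_abs (a (f (φ m)))]
    have : ε ^ 2 ≤ |a (f (φ m))| ^ 2 := by gcongr
    nlinarith [sq_nonneg (a (f (φ (m + 1))))]
  have h5 := (abs_le_of_sq_le_sq' h4 (norm_nonneg _)).2
  rw [Function.comp_apply, Function.comp_apply, dist_eq_norm] at h1
  linarith

end Compact

/-! ### Enumerating positive numbers in decreasing order -/

section Sorting

/-- Positive numbers that tend to zero along the cofinite filter can be listed in decreasing order,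
with repetitions: only finitely many are at least as large as a given one, so each has a rank. -/
theorem exists_antitone_enumeration {I : Type*} {a : I → ℝ} (ha : ∀ i, 0 < a i)
    (h0 : Tendsto a cofinite (𝓝 0)) :
    ∃ (n : ℕ∞) (e : Idx n ≃ I), Antitone fun i => a (e i) := by
  classical
  have hfin : ∀ i, {j | a i ≤ a j}.Finite := by
    intro i
    have := h0.eventually (gt_mem_nhds (ha i))
    rw [Filter.eventually_cofinite] at this
    simpa using this
  let _ : LinearOrder I := linearOrderOfSTO WellOrderingRel
  -- ties are broken by an arbitrary linear order on the index type
  let key : I → Lex (ℝᵒᵈ × I) := fun i => toLex (OrderDual.toDual (a i), i)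
  have hkey : Function.Injective key := fun i j h => by
    have := congrArg (fun p => (ofLex p).2) h
    simpa [key] using this
  have hle : ∀ {i j}, key j ≤ key i → a i ≤ a j := by
    intro i j h
    rcases Prod.Lex.le_iff.1 h with h | h
    · exact (OrderDual.toDual_lt_toDual.1 h).le
    · exact (OrderDual.toDual_inj.1 h.1).ge
  have hfin' : ∀ i, {j | key j < key i}.Finite := fun i =>
    (hfin i).subset fun j hj => hle (le_of_lt hj)
  let rank : I → ℕ := fun i => {j | key j < key i}.ncard
  have hrank : ∀ {i j}, key i < key j → rank i < rank j := by
    intro i j h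
    refine Set.ncard_lt_ncard ⟨fun k hk => lt_trans hk h, fun hs => ?_⟩ (hfin' j)
    exact lt_irrefl (key i) (hs (show i ∈ {k | key k < key j} from h))
  have hinj : Function.Injective rank := by
    intro i j h
    by_contra hne
    rcases lt_or_gt_of_ne (hkey.ne hne) with h' | h'
    · exact (hrank h').ne h
    · exact (hrank h').ne' h
  have hanti : ∀ {i j}, rank i ≤ rank j → a j ≤ a i := by
    intro i j h
    by_contra hlt
    refine absurd h (not_le.2 (hrank ?_))
    by_contra hk
    exact hlt (hle (not_lt.1 hk))
  let er : I ≃ Set.range rank := Equiv.ofInjective rank hinj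
  have her : ∀ x : Set.range rank, rank (er.symm x) = x := fun x => by
    conv_rhs => rw [← er.apply_symm_apply x]
    rfl
  have main : ∀ (n : ℕ∞) (o : Idx n ≃o Set.range rank),
      ∃ (n : ℕ∞) (e : Idx n ≃ I), Antitone fun i => a (e i) := by
    intro n o
    refine ⟨n, o.toEquiv.trans er.symm, fun i j hij => hanti ?_⟩
    simp only [Equiv.trans_apply, her]
    exact o.monotone hij
  rcases (Set.range rank).finite_or_infinite with hf | hi
  · have : Fintype (Set.range rank) := hf.fintype
    refine main (Fintype.card (Set.range rank) : ℕ∞) (OrderIso.trans ?_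
      (Fintype.orderIsoFinOfCardEq (Set.range rank) rfl).symm.symm)
    exact
      { toFun := fun i => ⟨i.1, by exact_mod_cast i.2⟩
        invFun := fun i => ⟨i.1, by exact_mod_cast i.2⟩
        left_inv := fun _ => rfl
        right_inv := fun _ => rfl
        map_rel_iff' := Iff.rfl }
  · have : Infinite (Set.range rank) := hi.to_subtype
    refine main ⊤ (OrderIso.trans ?_ (Nat.Subtype.orderIsoOfNat (Set.range rank)))
    exact
      { toFun := fun i => i.1
        invFun := fun i => ⟨i, ENat.natCast_lt_top i⟩
        left_inv := fun _ => rfl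
        right_inv := fun _ => rfl
        map_rel_iff' := Iff.rfl }

end Sorting


/-! ### Eigensystems of positive compact operators -/

section EigenSystems

variable {E : Type*} [NormedAddCommGroup E] [InnerProductSpace ℝ E] {L : E →L[ℝ] E}

theorem EigenSystem.tendsto_eig {n : ℕ∞} {J : Type} (e : EigenSystem L n J)
    (hc : IsCompactOperator L) : Tendsto e.eig cofinite (𝓝 0) :=
  tendsto_eigenvalue_cofinite hc (e.basis.orthonormal.comp Sum.inl Sum.inl_injective) e.apply_inl

theorem EigenSystem.hasSum_repr_sq {n : ℕ∞} {J : Type} (e : EigenSystem L n J) (φ : E) :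
    HasSum (fun m => e.basis.repr φ m ^ 2) (‖φ‖ ^ 2) := by
  have := e.basis.hasSum_inner_mul_inner φ φ
  rw [real_inner_self_eq_norm_sq] at this
  refine this.congr_fun fun m => ?_
  rw [e.basis.repr_apply_apply, real_inner_comm, sq]

theorem EigenSystem.hasSum_eig_mul_repr_sq {n : ℕ∞} {J : Type} (e : EigenSystem L n J)
    (hL : L.IsSymmetric) (φ : E) :
    HasSum (fun i => e.eig i * e.basis.repr φ (Sum.inl i) ^ 2) ⟪φ, L φ⟫_ℝ := by
  have h := e.basis.hasSum_inner_mul_inner φ (L φ)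
  have hr : ∀ j, ⟪φ, e.basis (Sum.inr j)⟫_ℝ * ⟪e.basis (Sum.inr j), L φ⟫_ℝ = 0 := by
    intro j
    have := hL (e.basis (Sum.inr j)) φ
    simp only [ContinuousLinearMap.coe_coe] at this
    rw [← this, e.apply_inr, inner_zero_left, mul_zero]
  rw [← Sum.inl_injective.hasSum_iff] at h
  · refine h.congr_fun fun i => ?_
    have := hL (e.basis (Sum.inl i)) φ
    simp only [ContinuousLinearMap.coe_coe] at this
    simp only [Function.comp_apply]
    rw [← this, e.apply_inl, inner_smul_left, e.basis.repr_apply_apply,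
      real_inner_comm φ]
    simp
    ring
  · rintro (i | j) hx
    · exact absurd ⟨i, rfl⟩ hx
    · exact hr j

end EigenSystems

theorem exists_eigenSystem {E : Type} [NormedAddCommGroup E] [InnerProductSpace ℝ E]
    [CompleteSpace E] {L : E →L[ℝ] E} (hc : IsCompactOperator L) (hL : L.IsPositive) :
    ∃ (n : ℕ∞) (J : Type), Nonempty (EigenSystem L n J) := by
  classical
  obtain ⟨I, b, a, ha⟩ := exists_hilbertBasis_of_isCompactOperator hc hL.isSymmetric
  have hnn : ∀ i, 0 ≤ a i := by
    intro i
    have := hL.inner_nonneg_right (b i)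
    rwa [ha, inner_smul_right, real_inner_self_eq_norm_sq, b.orthonormal.1, one_pow,
      mul_one] at this
  have h0 := tendsto_eigenvalue_cofinite hc b.orthonormal ha
  obtain ⟨n, o, ho⟩ := exists_antitone_enumeration (I := {i // 0 < a i}) (a := fun i => a i)
    (fun i => i.2) (h0.comp Subtype.val_injective.tendsto_cofinite)
  let J : Type := {i : I // ¬ 0 < a i}
  let q : Idx n ⊕ J ≃ I := (Equiv.sumCongr o (Equiv.refl J)).trans (Equiv.sumCompl fun i => 0 < a i)
  have hq : Orthonormal ℝ (b ∘ q) := b.orthonormal.comp q q.injective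
  have hsp : ⊤ ≤ (Submodule.span ℝ (Set.range (b ∘ q))).topologicalClosure := by
    rw [q.surjective.range_comp, b.dense_span]
  refine ⟨n, J, ⟨⟨HilbertBasis.mk hq hsp, fun i => a (o i), fun i => (o i).2, ho, fun i => ?_,
    fun j => ?_⟩⟩⟩
  · simp only [HilbertBasis.coe_mk, Function.comp_apply]
    exact ha _
  · simp only [HilbertBasis.coe_mk, Function.comp_apply]
    have : a j.1 = 0 := le_antisymm (not_lt.1 j.2) (hnn _)
    change L (b j.1) = 0
    rw [ha, this, zero_smul]

/-! ### Diagonal operators and square roots -/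

section Diagonal

variable {E : Type*} [NormedAddCommGroup E] [InnerProductSpace ℝ E]

theorem continuousLinearMap_ext_hilbertBasis {I F : Type*} [NormedAddCommGroup F]
    [InnerProductSpace ℝ F] (b : HilbertBasis I ℝ E) {S T : E →L[ℝ] F}
    (h : ∀ i, S (b i) = T (b i)) : S = T := by
  refine ContinuousLinearMap.ext_on (s := Set.range b) ?_ ?_
  · rw [Submodule.dense_iff_topologicalClosure_eq_top, b.dense_span]
  · rintro _ ⟨i, rfl⟩
    exact h i

/-- A bounded family of nonnegative numbers is the family of eigenvalues of a positive bounded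
operator that is diagonal in a given Hilbert basis. -/
theorem exists_diagonal {I : Type*} (b : HilbertBasis I ℝ E) {a : I → ℝ} {C : ℝ}
    (ha : ∀ i, 0 ≤ a i) (hC : ∀ i, a i ≤ C) :
    ∃ S : E →L[ℝ] E, S.IsPositive ∧ ∀ i, S (b i) = a i • b i := by
  classical
  have hbd : ∀ x : E, Memℓp (fun i => a i * b.repr x i) 2 := by
    intro x
    have hx := (lp.memℓp (b.repr x)).summable (by simp)
    refine memℓp_gen ?_
    refine Summable.of_nonneg_of_le (fun i => by positivity) (fun i => ?_) (hx.mul_left (C ^ 2))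
    simp only [ENNReal.toReal_ofNat, Real.rpow_two, norm_mul, mul_pow, Real.norm_eq_abs, sq_abs]
    have := ha i
    have := hC i
    gcongr
  let Sl : E →ₗ[ℝ] E :=
    { toFun := fun x => b.repr.symm ⟨fun i => a i * b.repr x i, hbd x⟩
      map_add' := fun x y => by
        rw [← map_add]
        congr 1
        ext i
        exact (by simp [mul_add] : a i * b.repr (x + y) i = a i * b.repr x i + a i * b.repr y i)
      map_smul' := fun c x => by
        rw [RingHom.id_apply, ← map_smul]
        congr 1
        ext i
        exact (by simp [mul_left_comm] : a i * b.repr (c • x) i = c * (a i * b.repr x i)) }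
  have hrepr : ∀ x i, b.repr (Sl x) i = a i * b.repr x i := fun x i => by simp [Sl]
  have hnorm : ∀ x, ‖Sl x‖ ≤ |C| * ‖x‖ := by
    intro x
    have h1 := b.hasSum_inner_mul_inner (Sl x) (Sl x)
    have h2 := (b.hasSum_inner_mul_inner x x).mul_left (C ^ 2)
    rw [real_inner_self_eq_norm_sq] at h1 h2
    have h3 : ‖Sl x‖ ^ 2 ≤ C ^ 2 * ‖x‖ ^ 2 := by
      refine hasSum_le (fun i => ?_) h1 h2
      rw [real_inner_comm, real_inner_comm (b i) x, ← b.repr_apply_apply, ← b.repr_apply_apply,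
        hrepr]
      have h4 : a i ^ 2 ≤ C ^ 2 := by
        have := ha i
        have := hC i
        gcongr
      nlinarith [mul_le_mul_of_nonneg_right h4 (sq_nonneg (b.repr x i))]
    refine (abs_le_of_sq_le_sq' ?_ (by positivity)).2
    rwa [mul_pow, sq_abs]
  refine ⟨Sl.mkContinuous _ hnorm, ?_, fun i => ?_⟩
  · rw [ContinuousLinearMap.isPositive_iff]
    constructor
    · intro x y
      simp only [ContinuousLinearMap.coe_coe, LinearMap.mkContinuous_apply]
      refine (b.hasSum_inner_mul_inner (Sl x) y).unique
        ((b.hasSum_inner_mul_inner x (Sl y)).congr_fun fun i => ?_)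
      rw [real_inner_comm, real_inner_comm (b i) x, ← b.repr_apply_apply, ← b.repr_apply_apply,
        ← b.repr_apply_apply, ← b.repr_apply_apply, hrepr, hrepr]
      ring
    · intro x
      refine (b.hasSum_inner_mul_inner (Sl x) x).nonneg fun i => ?_
      rw [real_inner_comm, ← b.repr_apply_apply, ← b.repr_apply_apply, hrepr, mul_assoc]
      exact mul_nonneg (ha i) (mul_self_nonneg _)
  · apply b.repr.injective
    ext j
    rw [LinearMap.mkContinuous_apply, hrepr, map_smul]
    simp [b.repr_self, lp.single_apply, Pi.single_apply]
    split_ifs with h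
    · rw [h]
    · rfl

theorem EigenSystem.exists_isPosSqrt {L : E →L[ℝ] E} {n : ℕ∞} {J : Type}
    (e : EigenSystem L n J) : ∃ S, IsPosSqrt S L := by
  let a : Idx n ⊕ J → ℝ := Sum.elim (fun i => √(e.eig i)) fun _ => 0
  have hle : ∀ i, a i ≤ √‖L‖ := by
    rintro (i | j)
    · refine Real.sqrt_le_sqrt ?_
      have := L.le_opNorm (e.basis (Sum.inl i))
      rw [e.apply_inl, norm_smul, e.basis.orthonormal.1, mul_one, mul_one] at this
      exact (le_abs_self _).trans this
    · exact Real.sqrt_nonneg _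
  obtain ⟨S, hS, hSa⟩ := exists_diagonal e.basis (a := a)
    (by rintro (i | j) <;> simp [a]) hle
  refine ⟨S, hS, continuousLinearMap_ext_hilbertBasis e.basis ?_⟩
  rintro (i | j)
  · rw [ContinuousLinearMap.comp_apply, hSa, map_smul, hSa, smul_smul, e.apply_inl]
    simp [a, Real.mul_self_sqrt (e.eig_pos i).le]
  · rw [ContinuousLinearMap.comp_apply, hSa, e.apply_inr]
    simp [a]

end Diagonal

/-! ### Two factorizations of the same operator -/

section Factorization

variable {E F H : Type*} [NormedAddCommGroup E] [InnerProductSpace ℝ E] [CompleteSpace E]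
  [NormedAddCommGroup F] [InnerProductSpace ℝ F] [CompleteSpace F]
  [NormedAddCommGroup H] [InnerProductSpace ℝ H] [CompleteSpace H]

open ContinuousLinearMap in
/-- If `A A† = B B†`, then `A† y ↦ B† y` extends to an isometry of `(ker A)ᗮ` onto `(ker B)ᗮ` that
intertwines `A` and `B`. -/
theorem exists_mem_orthogonal_ker_of_comp_adjoint_eq {A : F →L[ℝ] E} {B : H →L[ℝ] E}
    (hAB : A ∘L adjoint A = B ∘L adjoint B) {x : F} (hx : x ∈ (A.ker)ᗮ) :
    ∃ y ∈ (B.ker)ᗮ, B y = A x ∧ ‖y‖ = ‖x‖ := by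
  have hnorm : ∀ z, ‖adjoint A z‖ = ‖adjoint B z‖ := by
    intro z
    have h : ‖adjoint A z‖ ^ 2 = ‖adjoint B z‖ ^ 2 := by
      rw [← real_inner_self_eq_norm_sq, ← real_inner_self_eq_norm_sq, adjoint_inner_left,
        adjoint_inner_left, ← comp_apply, hAB, comp_apply]
    exact (sq_eq_sq₀ (norm_nonneg _) (norm_nonneg _)).1 h
  have hx' : x ∈ closure (Set.range (adjoint A)) := by
    rw [ContinuousLinearMap.orthogonal_ker] at hx
    exact hx
  obtain ⟨w, hw, hlim⟩ := mem_closure_iff_seq_limit.1 hx'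
  choose z hz using hw
  have hcau : CauchySeq fun m => adjoint B (z m) := by
    rw [Metric.cauchySeq_iff]
    intro ε hε
    obtain ⟨m₀, h₀⟩ := Metric.cauchySeq_iff.1 hlim.cauchySeq ε hε
    refine ⟨m₀, fun m hm k hk => ?_⟩
    have := h₀ m hm k hk
    rwa [← hz, ← hz, dist_eq_norm, ← map_sub, hnorm, map_sub, ← dist_eq_norm] at this
  obtain ⟨y, hy⟩ := cauchySeq_tendsto_of_complete hcau
  refine ⟨y, ?_, ?_, ?_⟩
  · refine (Submodule.isClosed_orthogonal _).mem_of_tendsto hy (Eventually.of_forall fun m => ?_)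
    rw [SetLike.mem_coe, Submodule.mem_orthogonal]
    intro u hu
    have hu' : B u = 0 := hu
    rw [adjoint_inner_right, hu', inner_zero_left]
  · refine tendsto_nhds_unique ((B.continuous.tendsto y).comp hy)
      (((A.continuous.tendsto x).comp hlim).congr fun m => ?_)
    simp only [Function.comp_apply]
    rw [← hz, ← comp_apply, ← comp_apply, hAB]
  · refine tendsto_nhds_unique hy.norm (hlim.norm.congr fun m => ?_)
    rw [← hz, hnorm]

variable {S L : E →L[ℝ] E} {ι : H →L[ℝ] E}

open ContinuousLinearMap

theorem IsPosSqrt.comp_adjoint (hS : IsPosSqrt S L) : S ∘L adjoint S = L := by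
  rw [hS.1.isSelfAdjoint.adjoint_eq, hS.2]

theorem range_eq_of_comp_adjoint_eq (hS : IsPosSqrt S L) (hι : ι ∘L adjoint ι = L)
    (hinj : Function.Injective ι) : Set.range ι = Set.range S := by
  have hker : ι.ker = ⊥ := LinearMap.ker_eq_bot.2 hinj
  have h := hι.trans hS.comp_adjoint.symm
  apply Set.Subset.antisymm
  · rintro _ ⟨f, rfl⟩
    obtain ⟨w, -, hw, -⟩ := exists_mem_orthogonal_ker_of_comp_adjoint_eq h (x := f)
      (by rw [hker, Submodule.bot_orthogonal_eq_top]; trivial)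
    exact ⟨w, hw⟩
  · rintro _ ⟨x, rfl⟩
    obtain ⟨hp, hp'⟩ := pinv_spec S ⟨x, rfl⟩
    obtain ⟨f, -, hf, -⟩ := exists_mem_orthogonal_ker_of_comp_adjoint_eq h.symm hp
    exact ⟨f, hf.trans hp'⟩

/-- The inner product of `H` is transported by `S⁻¹ ι`, the isometry of `H` onto `(ker S)ᗮ`; it is
recovered from the norms by polarization. -/
theorem inner_eq_inner_pinv (hS : IsPosSqrt S L) (hι : ι ∘L adjoint ι = L)
    (hinj : Function.Injective ι) (f h : H) :
    ⟪f, h⟫_ℝ = ⟪pinv S (ι f), pinv S (ι h)⟫_ℝ := by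
  have hker : ι.ker = ⊥ := LinearMap.ker_eq_bot.2 hinj
  have hAB := hι.trans hS.comp_adjoint.symm
  have key : ∀ f, pinv S (ι f) ∈ (S.ker)ᗮ ∧ S (pinv S (ι f)) = ι f ∧ ‖pinv S (ι f)‖ = ‖f‖ := by
    intro f
    obtain ⟨w, hw, hwf, hn⟩ := exists_mem_orthogonal_ker_of_comp_adjoint_eq hAB (x := f)
      (by rw [hker, Submodule.bot_orthogonal_eq_top]; trivial)
    rw [eq_pinv S hw hwf]
    exact ⟨hw, hwf, hn⟩
  have hadd : pinv S (ι (f + h)) = pinv S (ι f) + pinv S (ι h) :=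
    eq_pinv S (Submodule.add_mem _ (key f).1 (key h).1)
      (by rw [map_add, map_add, (key f).2.1, (key h).2.1])
  have h1 := norm_add_sq_real f h
  have h2 := norm_add_sq_real (pinv S (ι f)) (pinv S (ι h))
  rw [← hadd, (key _).2.2, (key _).2.2, (key _).2.2, h1] at h2
  linarith

theorem EigenSystem.repr_inr_eq_zero {n : ℕ∞} {J : Type} (e : EigenSystem L n J)
    (hι : ι ∘L adjoint ι = L) (f : H) (j : J) : e.basis.repr (ι f) (Sum.inr j) = 0 := by
  have h : ‖adjoint ι (e.basis (Sum.inr j))‖ ^ 2 = 0 := by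
    rw [← real_inner_self_eq_norm_sq, adjoint_inner_left, ← comp_apply, hι, e.apply_inr,
      inner_zero_right]
  rw [e.basis.repr_apply_apply, ← adjoint_inner_left,
    norm_eq_zero.1 ((pow_eq_zero_iff two_ne_zero).1 h), inner_zero_left]

/-- The vectors `λᵢ^{-1/2} ι† ψᵢ` form a Hilbert basis of `H`. -/
theorem EigenSystem.hasSum_inv_eig_mul_repr_sq {n : ℕ∞} {J : Type} (e : EigenSystem L n J)
    (hι : ι ∘L adjoint ι = L) (hinj : Function.Injective ι) (f : H) :
    HasSum (fun i => (e.eig i)⁻¹ * e.basis.repr (ι f) (Sum.inl i) ^ 2) (‖f‖ ^ 2) := by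
  classical
  let v : Idx n → H := fun i => (√(e.eig i))⁻¹ • adjoint ι (e.basis (Sum.inl i))
  have hv : Orthonormal ℝ v := by
    rw [orthonormal_iff_ite]
    intro i j
    simp only [v]
    rw [real_inner_smul_left, real_inner_smul_right, adjoint_inner_left, ← comp_apply, hι,
      e.apply_inl, real_inner_smul_right, orthonormal_iff_ite.1 e.basis.orthonormal]
    by_cases hij : i = j
    · subst hij
      have := Real.mul_self_sqrt (e.eig_pos i).le
      have h0 : √(e.eig i) ≠ 0 := (Real.sqrt_pos.2 (e.eig_pos i)).ne'
      simp only [if_true]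
      field_simp
      rw [Real.sq_sqrt (e.eig_pos i).le]
    · simp [hij]
  have hinner : ∀ f i, ⟪f, v i⟫_ℝ = (√(e.eig i))⁻¹ * e.basis.repr (ι f) (Sum.inl i) := by
    intro f i
    rw [real_inner_smul_right, adjoint_inner_right, e.basis.repr_apply_apply, real_inner_comm]
  have hbot : (Submodule.span ℝ (Set.range v))ᗮ = ⊥ := by
    rw [Submodule.eq_bot_iff]
    intro f hf
    apply hinj
    rw [map_zero]
    apply e.basis.repr.injective
    rw [map_zero]
    ext m
    rcases m with i | j
    · have h := (Submodule.mem_orthogonal' _ _).1 hf (v i) (Submodule.subset_span ⟨i, rfl⟩)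
      rw [hinner] at h
      have h0 : (√(e.eig i))⁻¹ ≠ 0 := inv_ne_zero (Real.sqrt_pos.2 (e.eig_pos i)).ne'
      simpa [h0] using h
    · simpa using e.repr_inr_eq_zero hι f j
  have := (HilbertBasis.mkOfOrthogonalEqBot hv hbot).hasSum_inner_mul_inner f f
  rw [real_inner_self_eq_norm_sq] at this
  refine this.congr_fun fun i => ?_
  rw [HilbertBasis.coe_mkOfOrthogonalEqBot, real_inner_comm f (v i), hinner, ← sq, mul_pow, inv_pow,
    Real.sq_sqrt (e.eig_pos i).le]

end Factorization


/-! ### Feature maps -/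

section FeatureMaps

variable {X : Type*} [MeasurableSpace X] {μ : Measure X}
  {K : Type*} [NormedAddCommGroup K] [InnerProductSpace ℝ K] {Φ : X → K}

/-- `B` sends `h` to the class of `r ↦ ⟪Φ r, h⟫` in `L²(μ)`. -/
def IsAnalysisOperator (μ : Measure X) (Φ : X → K) (B : K →L[ℝ] Lp ℝ 2 μ) : Prop :=
  ∀ h, B h =ᵐ[μ] fun r => ⟪Φ r, h⟫_ℝ

/-- A feature map with a measurable kernel is weakly measurable: the vectors `h` for which
`⟪Φ ·, h⟫` is measurable form a closed subspace that contains the values of `Φ` and everything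
orthogonal to them. -/
theorem measurable_inner_of_measurable_kernel [CompleteSpace K]
    (hm : ∀ s, Measurable fun r => ⟪Φ r, Φ s⟫_ℝ) (h : K) : Measurable fun r => ⟪Φ r, h⟫_ℝ := by
  let V : Submodule ℝ K :=
    { carrier := {h | Measurable fun r => ⟪Φ r, h⟫_ℝ}
      add_mem' := fun {a b} ha hb => by
        simp only [Set.mem_ofPred_eq, inner_add_right] at *
        exact ha.add hb
      zero_mem' := by simp
      smul_mem' := fun c a ha => by
        simp only [Set.mem_ofPred_eq, inner_smul_right] at *
        exact ha.const_mul c }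
  have hV : IsClosed (V : Set K) := by
    rw [← closure_subset_iff_isClosed]
    intro x hx
    obtain ⟨y, hy, hlim⟩ := mem_closure_iff_seq_limit.1 hx
    exact measurable_of_tendsto_metrizable hy
      (tendsto_pi_nhds.2 fun r => tendsto_const_nhds.inner hlim)
  have hΦ : ∀ r, Φ r ∈ V := hm
  have hV' : CompleteSpace V := hV.completeSpace_coe
  obtain ⟨a, ha, b, hb, rfl⟩ := V.exists_add_mem_mem_orthogonal h
  have : (fun r => ⟪Φ r, a + b⟫_ℝ) = fun r => ⟪Φ r, a⟫_ℝ := by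
    funext r
    rw [inner_add_right, (Submodule.mem_orthogonal _ _).1 hb (Φ r) (hΦ r), add_zero]
  rw [this]
  exact ha

/-- A weakly measurable, square integrable feature map has an analysis operator. -/
theorem exists_isAnalysisOperator (hm : ∀ h, AEStronglyMeasurable (fun r => ⟪Φ r, h⟫_ℝ) μ)
    (hi : Integrable (fun r => ‖Φ r‖ ^ 2) μ) : ∃ B, IsAnalysisOperator μ Φ B := by
  have hle : ∀ h r, ⟪Φ r, h⟫_ℝ ^ 2 ≤ ‖h‖ ^ 2 * ‖Φ r‖ ^ 2 := by
    intro h r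
    rw [← sq_abs, mul_comm, ← mul_pow]
    have := abs_real_inner_le_norm (Φ r) h
    gcongr
  have hmem : ∀ h, MemLp (fun r => ⟪Φ r, h⟫_ℝ) 2 μ := by
    intro h
    rw [memLp_two_iff_integrable_sq (hm h)]
    refine (hi.const_mul (‖h‖ ^ 2)).mono' ((hm h).pow 2) (Eventually.of_forall fun r => ?_)
    rw [Real.norm_eq_abs, abs_of_nonneg (sq_nonneg _)]
    exact hle h r
  let Bl : K →ₗ[ℝ] Lp ℝ 2 μ :=
    { toFun := fun h => (hmem h).toLp _
      map_add' := fun f g => by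
        rw [← MemLp.toLp_add]
        congr 1
        funext r
        exact inner_add_right _ _ _
      map_smul' := fun c f => by
        rw [RingHom.id_apply, ← MemLp.toLp_const_smul]
        congr 1
        funext r
        exact inner_smul_right _ _ _ }
  refine ⟨Bl.mkContinuous (√(∫ r, ‖Φ r‖ ^ 2 ∂μ)) fun h => ?_, fun h => (hmem h).coeFn_toLp⟩
  have h0 : 0 ≤ ∫ r, ‖Φ r‖ ^ 2 ∂μ := integral_nonneg fun r => by positivity
  refine (abs_le_of_sq_le_sq' ?_ (by positivity)).2
  rw [mul_pow, Real.sq_sqrt h0, ← real_inner_self_eq_norm_sq, L2.inner_def,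
    ← integral_mul_const]
  refine integral_mono_ae (L2.integrable_inner _ _) (hi.mul_const _) ?_
  filter_upwards [(hmem h).coeFn_toLp] with r hr
  change ⟪((hmem h).toLp _ : X → ℝ) r, ((hmem h).toLp _ : X → ℝ) r⟫_ℝ ≤ _
  rw [hr, real_inner_self_eq_norm_sq, Real.norm_eq_abs, sq_abs, mul_comm]
  exact hle h r

variable {B : K →L[ℝ] Lp ℝ 2 μ}

theorem IsAnalysisOperator.integrable_mul (hB : IsAnalysisOperator μ Φ B) (φ : Lp ℝ 2 μ) (h : K) :
    Integrable (fun r => φ r * ⟪Φ r, h⟫_ℝ) μ := by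
  refine (L2.integrable_inner (𝕜 := ℝ) (B h) φ).congr ?_
  filter_upwards [hB h] with r hr
  rw [hr]
  simp

theorem IsAnalysisOperator.inner_eq (hB : IsAnalysisOperator μ Φ B) (φ : Lp ℝ 2 μ) (h : K) :
    ⟪φ, B h⟫_ℝ = ∫ r, φ r * ⟪Φ r, h⟫_ℝ ∂μ := by
  rw [L2.inner_def]
  refine integral_congr_ae ?_
  filter_upwards [hB h] with r hr
  rw [hr]
  simp [mul_comm]

variable [CompleteSpace K]

open ContinuousLinearMap

/-- `B B†` is the integral operator with the Gram kernel of the feature map. -/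
theorem IsAnalysisOperator.comp_adjoint_apply (hB : IsAnalysisOperator μ Φ B) (φ : Lp ℝ 2 μ) :
    (B ∘L adjoint B) φ =ᵐ[μ] fun r => ∫ s, φ s * ⟪Φ r, Φ s⟫_ℝ ∂μ := by
  filter_upwards [hB (adjoint B φ)] with r hr
  rw [comp_apply, hr, adjoint_inner_right, real_inner_comm, hB.inner_eq]
  simp only [real_inner_comm (Φ r)]

/-- The analysis operator of a square integrable feature map is Hilbert-Schmidt: by Bessel's
inequality `∑ ‖B bᵢ‖² ≤ ∫ ‖Φ‖²` for orthonormal `bᵢ`. -/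
theorem IsAnalysisOperator.isCompactOperator (hB : IsAnalysisOperator μ Φ B)
    (hi : Integrable (fun r => ‖Φ r‖ ^ 2) μ) : IsCompactOperator B := by
  obtain ⟨w, b, -⟩ := exists_hilbertBasis ℝ K
  refine isCompactOperator_of_summable_norm_sq B b
    (summable_of_sum_le (c := ∫ r, ‖Φ r‖ ^ 2 ∂μ) (fun i => by positivity) fun s => ?_)
  have h1 : ∀ i, ‖B (b i)‖ ^ 2 = ∫ r, ‖⟪b i, Φ r⟫_ℝ‖ ^ 2 ∂μ := by
    intro i
    rw [← real_inner_self_eq_norm_sq, L2.inner_def]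
    refine integral_congr_ae ?_
    filter_upwards [hB (b i)] with r hr
    rw [hr, real_inner_self_eq_norm_sq, real_inner_comm]
  have h2 : ∀ i, Integrable (fun r => ‖⟪b i, Φ r⟫_ℝ‖ ^ 2) μ := by
    intro i
    refine (L2.integrable_inner (𝕜 := ℝ) (B (b i)) (B (b i))).congr ?_
    filter_upwards [hB (b i)] with r hr
    rw [hr, real_inner_self_eq_norm_sq, real_inner_comm]
  simp only [h1]
  rw [← integral_finsetSum _ fun i _ => h2 i]
  exact integral_mono (integrable_finsetSum _ fun i _ => h2 i) hi
    fun r => b.orthonormal.sum_inner_products_le (Φ r)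

end FeatureMaps

/-- A finite sum of Gram kernels is positive semi-definite. -/
theorem posSemidef_of_eq_sum_inner {X ι K : Type*} [Fintype ι] [NormedAddCommGroup K]
    [InnerProductSpace ℝ K] {Φ : ι → X → K} {c : ℝ} (hc : 0 ≤ c) {k : X → X → ℝ}
    (hk : ∀ r s, k r s = c * ∑ i, ⟪Φ i r, Φ i s⟫_ℝ) :
    (Matrix.of fun r s => k r s • ContinuousLinearMap.id ℝ ℝ :
      Matrix X X (ℝ →L[ℝ] ℝ)).PosSemidef := by
  refine (RKHS.posSemidef_tfae.out 0 2 :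
    _ ↔ _ ∧ ∀ v : X →₀ ℝ, 0 ≤ RCLike.re _).2 ⟨?_, fun v => ?_⟩
  · ext r s
    simp only [Matrix.conjTranspose_apply, Matrix.of_apply, hk]
    rw [star_smul]
    simp only [real_inner_comm (Φ _ s)]
    rw [show star (ContinuousLinearMap.id ℝ ℝ) = ContinuousLinearMap.id ℝ ℝ from
      star_one (R := ℝ →L[ℝ] ℝ)]
    simp
  · have : (v.sum fun x w => v.sum fun x' w' => ⟪(Matrix.of fun r s =>
        k r s • ContinuousLinearMap.id ℝ ℝ : Matrix X X (ℝ →L[ℝ] ℝ)) x' x w, w'⟫_ℝ)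
        = c * ∑ i, ‖v.sum fun x w => w • Φ i x‖ ^ 2 := by
      simp only [← real_inner_self_eq_norm_sq, Finsupp.sum, sum_inner, inner_sum, Matrix.of_apply,
        real_inner_smul_left, real_inner_smul_right, Finset.mul_sum]
      rw [Finset.sum_comm]
      conv_rhs => rw [Finset.sum_comm]; enter [2, x]; rw [Finset.sum_comm]
      refine Finset.sum_congr rfl fun x _ => Finset.sum_congr rfl fun y _ => ?_
      simp [hk, Finset.mul_sum]
      rw [Finset.sum_mul, Finset.mul_sum]
      refine Finset.sum_congr rfl fun i _ => ?_
      rw [real_inner_comm (Φ i x)]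
      ring
    rw [this, RCLike.re_to_real]
    positivity

/-! ### Kernel sections -/

section Reproducing

variable {X H : Type*} [NormedAddCommGroup H] [InnerProductSpace ℝ H] [CompleteSpace H]
  [RKHS ℝ H X ℝ]

/-- The kernel section `K_r` of a reproducing kernel Hilbert space of scalar functions. -/
def kerSection (H : Type*) [NormedAddCommGroup H] [InnerProductSpace ℝ H] [CompleteSpace H]
    [RKHS ℝ H X ℝ] (r : X) : H :=
  RKHS.kerFun H r 1

theorem inner_kerSection (f : H) (r : X) : ⟪kerSection H r, f⟫_ℝ = f r := by
  simp [kerSection]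

theorem inner_kerSection_kerSection {k : X → X → ℝ}
    (hk : RKHS.kernel H = Matrix.of fun r s => k r s • ContinuousLinearMap.id ℝ ℝ) (r s : X) :
    ⟪kerSection H r, kerSection H s⟫_ℝ = k r s := by
  rw [inner_kerSection, kerSection, RKHS.kerFun_apply, hk]
  simp

end Reproducing


/-! ### Polar coordinates -/

section Polar

variable {d : ℕ}

/-- The measure `1_{r > 0} r^{d-1} dr` on the line. -/
def radialMeasure (d : ℕ) : Measure ℝ :=
  (Measure.volumeIoiPow (d - 1)).map ((↑) : Set.Ioi (0 : ℝ) → ℝ)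

instance (d : ℕ) : SFinite (radialMeasure d) := by
  unfold radialMeasure
  infer_instance

theorem lintegral_radialMeasure {f : ℝ → ENNReal} (hf : Measurable f) :
    ∫⁻ r, f r ∂radialMeasure d = ∫⁻ r in Set.Ioi 0, ENNReal.ofReal (r ^ (d - 1)) * f r := by
  rw [radialMeasure, lintegral_map hf measurable_subtype_coe, Measure.volumeIoiPow,
    lintegral_withDensity_eq_lintegral_mul _ (by fun_prop) (by fun_prop)]
  simp only [Pi.mul_apply]
  rw [lintegral_subtype_comap measurableSet_Ioi fun r => ENNReal.ofReal (r ^ (d - 1)) * f r]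

theorem ae_pos_radialMeasure : ∀ᵐ r ∂radialMeasure d, 0 < r := by
  rw [radialMeasure, ae_map_iff measurable_subtype_coe.aemeasurable measurableSet_Ioi]
  exact Eventually.of_forall fun r => r.2

theorem radialMeasure_Iio_lt_top (R : ℝ) : radialMeasure d (Set.Iio R) < ⊤ := by
  rw [radialMeasure, Measure.map_apply measurable_subtype_coe measurableSet_Iio]
  rcases le_or_gt R 0 with hR | hR
  · have : ((↑) : Set.Ioi (0 : ℝ) → ℝ) ⁻¹' Set.Iio R = ∅ := by
      ext r
      simpa using hR.trans r.2.out.le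
    simp [this]
  · exact (Measure.volumeIoiPow_apply_Iio (d - 1) ⟨R, hR⟩).trans_lt ENNReal.ofReal_lt_top

/-- Integration in polar coordinates. -/
theorem map_smul_sphereMeasure_prod (hd : 0 < d) :
    Measure.map (fun p : Metric.sphere (0 : Sp d) 1 × ℝ => p.2 • (p.1 : Sp d))
      ((sphereMeasure d).prod (radialMeasure d)) = volume := by
  have : Nonempty (Fin d) := ⟨⟨0, hd⟩⟩
  have hm : Measurable fun p : Metric.sphere (0 : Sp d) 1 × ℝ => p.2 • (p.1 : Sp d) := by
    fun_prop
  have h1 : (sphereMeasure d).prod (radialMeasure d) =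
      ((sphereMeasure d).prod (Measure.volumeIoiPow (d - 1))).map
        (Prod.map id ((↑) : Set.Ioi (0 : ℝ) → ℝ)) := by
    rw [← Measure.map_prod_map _ _ measurable_id measurable_subtype_coe, Measure.map_id]
    rfl
  have h2 := (volume : Measure (Sp d)).measurePreserving_homeomorphUnitSphereProd
  rw [finrank_euclideanSpace_fin] at h2
  rw [h1, Measure.map_map hm (by fun_prop), ← h2.map_eq,
    Measure.map_map (by fun_prop) (homeomorphUnitSphereProd (Sp d)).measurable]
  have h3 : ((fun p : Metric.sphere (0 : Sp d) 1 × ℝ => p.2 • (p.1 : Sp d)) ∘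
      Prod.map id ((↑) : Set.Ioi (0 : ℝ) → ℝ)) ∘ homeomorphUnitSphereProd (Sp d) = (↑) := by
    funext x
    have := (homeomorphUnitSphereProd (Sp d)).symm_apply_apply x
    conv_rhs => rw [← this]
    rfl
  rw [h3, (MeasurableEmbedding.subtype_coe (measurableSet_singleton _).compl).map_comap,
    Subtype.range_coe, restrict_compl_singleton]

theorem lintegral_polar (hd : 0 < d) {f : Sp d → ENNReal} (hf : Measurable f) :
    ∫⁻ y, f y = ∫⁻ r, ∫⁻ ξ, f (r • (ξ : Sp d)) ∂sphereMeasure d ∂radialMeasure d := by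
  rw [← map_smul_sphereMeasure_prod hd, lintegral_map hf (by fun_prop),
    lintegral_prod_symm _ (by fun_prop)]

theorem integral_polar (hd : 0 < d) {f : Sp d → ℝ} (hf : Integrable f) :
    ∫ y, f y = ∫ r, ∫ ξ, f (r • (ξ : Sp d)) ∂sphereMeasure d ∂radialMeasure d := by
  have hm : AEMeasurable (fun p : Metric.sphere (0 : Sp d) 1 × ℝ => p.2 • (p.1 : Sp d))
    ((sphereMeasure d).prod (radialMeasure d)) := by fun_prop
  rw [← map_smul_sphereMeasure_prod hd] at hf
  conv_lhs => rw [← map_smul_sphereMeasure_prod hd]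
  rw [integral_map hm hf.1, integral_prod_symm]
  exact hf.comp_aemeasurable hm

theorem norm_smul_sphere {r : ℝ} (hr : 0 < r) (ξ : Metric.sphere (0 : Sp d) 1) :
    ‖r • (ξ : Sp d)‖ = r := by
  rw [norm_smul, norm_eq_of_mem_sphere, mul_one, Real.norm_of_nonneg hr.le]

end Polar

/-! ### Integrals over spheres -/

section SphereIntegrals

variable {d : ℕ} {Ω : Set (Sp d)} {M : ℝ} {w : Sp d → Sp d → ℝ}

/-- A bounded measurable function of two variables that vanishes for `y ∉ Ω` and is continuous
in `y ∈ Ω`. -/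
structure IsBoundedKernel (Ω : Set (Sp d)) (M : ℝ) (w : Sp d → Sp d → ℝ) : Prop where
  measurable : Measurable fun p : Sp d × Sp d => w p.1 p.2
  abs_le : ∀ x y, |w x y| ≤ M
  eq_zero : ∀ x, ∀ y ∉ Ω, w x y = 0
  continuousOn : ∀ x, ContinuousOn (w x) Ω

theorem IsBoundedKernel.abs (hw : IsBoundedKernel Ω M w) :
    IsBoundedKernel Ω M fun x y => |w x y| where
  measurable := hw.measurable.abs
  abs_le x y := by rw [abs_abs]; exact hw.abs_le x y
  eq_zero x y hy := by rw [hw.eq_zero x y hy, abs_zero]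
  continuousOn x := (hw.continuousOn x).abs

/-- The integral of `w x` over the directions of the sphere of radius `r`. -/
def sphereIntegral (w : Sp d → Sp d → ℝ) (r : ℝ) (x : Sp d) : ℝ :=
  ∫ ξ, w x (r • (ξ : Sp d)) ∂sphereMeasure d

theorem IsBoundedKernel.measurable_sphereIntegral (hw : IsBoundedKernel Ω M w) :
    Measurable fun p : ℝ × Sp d => sphereIntegral w p.1 p.2 := by
  have h : Measurable fun q : (ℝ × Sp d) × Metric.sphere (0 : Sp d) 1 =>
      w q.1.2 (q.1.1 • (q.2 : Sp d)) :=
    hw.measurable.comp (f := fun q : (ℝ × Sp d) × Metric.sphere (0 : Sp d) 1 =>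
      (q.1.2, q.1.1 • (q.2 : Sp d))) (by fun_prop)
  exact (h.stronglyMeasurable.integral_prod_right).measurable

theorem IsBoundedKernel.integrable_sphere (hw : IsBoundedKernel Ω M w) (r : ℝ) (x : Sp d) :
    Integrable (fun ξ : Metric.sphere (0 : Sp d) 1 => w x (r • (ξ : Sp d))) (sphereMeasure d) :=
  Integrable.of_bound (C := M) (hw.measurable.comp (f := fun ξ : Metric.sphere (0 : Sp d) 1 =>
      (x, r • (ξ : Sp d))) (by fun_prop)).aestronglyMeasurable
    (Eventually.of_forall fun ξ => hw.abs_le _ _)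

theorem IsBoundedKernel.abs_sphereIntegral_le (hw : IsBoundedKernel Ω M w) (r : ℝ) (x : Sp d) :
    |sphereIntegral w r x| ≤ M * (sphereMeasure d).real Set.univ := by
  have := norm_integral_le_of_norm_le_const (μ := sphereMeasure d) (C := M)
    (f := fun ξ => w x (r • (ξ : Sp d))) (Eventually.of_forall fun ξ => hw.abs_le _ _)
  exact this

theorem abs_sphereIntegral_le_sphereIntegral_abs (r : ℝ) (x : Sp d) :
    |sphereIntegral w r x| ≤ sphereIntegral (fun x y => |w x y|) r x :=
  abs_integral_le_integral_abs

theorem IsBoundedKernel.sphereIntegral_eq_zero (hw : IsBoundedKernel Ω M w) {r : ℝ} (hr : 0 < r)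
    (h : ∀ y ∈ Ω, ‖y‖ ≠ r) (x : Sp d) : sphereIntegral w r x = 0 := by
  have : ∀ ξ : Metric.sphere (0 : Sp d) 1, w x (r • (ξ : Sp d)) = 0 := fun ξ =>
    hw.eq_zero _ _ fun hy => h _ hy (norm_smul_sphere hr ξ)
  simp [sphereIntegral, this]

/-- Sphere integrals are continuous in the radius along every filter along which the part of `Ω`
that appears in new directions has vanishing measure. -/
theorem IsBoundedKernel.tendsto_sphereIntegral (hw : IsBoundedKernel Ω M w) (hΩ : IsOpen Ω)
    {r : ℝ} {l : Filter ℝ} [l.IsCountablyGenerated] (hl : l ≤ 𝓝 r)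
    (hbad : Tendsto (fun s : ℝ => sphereMeasure d {ξ | r • (ξ : Sp d) ∉ Ω ∧ s • (ξ : Sp d) ∈ Ω})
      l (𝓝 0)) (x : Sp d) :
    Tendsto (fun s => sphereIntegral w s x) l (𝓝 (sphereIntegral w r x)) := by
  let A : Set (Metric.sphere (0 : Sp d) 1) := {ξ | r • (ξ : Sp d) ∈ Ω}
  have hA : MeasurableSet A :=
    (hΩ.preimage (by fun_prop : Continuous fun ξ : Metric.sphere (0 : Sp d) 1 =>
      r • (ξ : Sp d))).measurableSet
  have hsplit : ∀ s, sphereIntegral w s x = (∫ ξ in A, w x (s • (ξ : Sp d)) ∂sphereMeasure d) +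
      ∫ ξ in Aᶜ, w x (s • (ξ : Sp d)) ∂sphereMeasure d := fun s =>
    (integral_add_compl hA (hw.integrable_sphere s x)).symm
  have h1 : Tendsto (fun s => ∫ ξ in A, w x (s • (ξ : Sp d)) ∂sphereMeasure d) l
      (𝓝 (∫ ξ in A, w x (r • (ξ : Sp d)) ∂sphereMeasure d)) := by
    refine tendsto_integral_filter_of_dominated_convergence (fun _ => M)
      (Eventually.of_forall fun s => (hw.integrable_sphere s x).1.restrict)
      (Eventually.of_forall fun s => Eventually.of_forall fun ξ => hw.abs_le _ _)
      (integrable_const _) ?_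
    filter_upwards [ae_restrict_mem hA] with ξ hξ
    have hc : ContinuousAt (w x) (r • (ξ : Sp d)) :=
      (hw.continuousOn x).continuousAt (hΩ.mem_nhds hξ)
    have hs : Tendsto (fun s : ℝ => s • (ξ : Sp d)) l (𝓝 (r • (ξ : Sp d))) :=
      ((by fun_prop : Continuous fun s : ℝ => s • (ξ : Sp d)).tendsto r).mono_left hl
    exact hc.tendsto.comp hs
  have h2 : ∫ ξ in Aᶜ, w x (r • (ξ : Sp d)) ∂sphereMeasure d = 0 := by
    rw [setIntegral_congr_fun (g := fun _ => (0 : ℝ)) hA.compl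
      fun ξ hξ => hw.eq_zero _ _ hξ, integral_zero]
  have h3 : Tendsto (fun s => ∫ ξ in Aᶜ, w x (s • (ξ : Sp d)) ∂sphereMeasure d) l (𝓝 0) := by
    have hb := (ENNReal.tendsto_toReal ENNReal.zero_ne_top).comp hbad
    refine squeeze_zero_norm (a := fun s => M * (sphereMeasure d
      {ξ | r • (ξ : Sp d) ∉ Ω ∧ s • (ξ : Sp d) ∈ Ω}).toReal) (fun s => ?_)
      (by simpa using hb.const_mul M)
    let D : Set (Metric.sphere (0 : Sp d) 1) := {ξ | s • (ξ : Sp d) ∈ Ω}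
    have hD : MeasurableSet D :=
      (hΩ.preimage (by fun_prop : Continuous fun ξ : Metric.sphere (0 : Sp d) 1 =>
        s • (ξ : Sp d))).measurableSet
    have h4 : ∫ ξ in Aᶜ, w x (s • (ξ : Sp d)) ∂sphereMeasure d
        = ∫ ξ in Aᶜ ∩ D, w x (s • (ξ : Sp d)) ∂sphereMeasure d := by
      refine (setIntegral_eq_of_subset_of_forall_sdiff_eq_zero hA.compl Set.inter_subset_left
        fun ξ hξ => hw.eq_zero _ _ fun h => hξ.2 ⟨hξ.1, h⟩)
    rw [h4]
    exact norm_setIntegral_le_of_norm_le_const (measure_lt_top _ _) fun ξ _ => hw.abs_le _ _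
  simp only [hsplit]
  exact h1.add (h2 ▸ h3)

end SphereIntegrals


/-! ### The exploration measure -/

section Exploration

variable {d N : ℕ} {𝕏 : Type*} {Ω : Set (Sp d)} {g : 𝕏 → Sp d → Sp d → ℝ} {u : Fin N → 𝕏} {M : ℝ}

/-- The standing assumptions on the domain and the data, apart from radial regularity. -/
structure IsAdmissible (Ω : Set (Sp d)) (g : 𝕏 → Sp d → Sp d → ℝ) (u : Fin N → 𝕏) (M : ℝ) :
    Prop where
  pos : 0 < d
  isOpen : IsOpen Ω
  isBounded : Bornology.IsBounded Ω
  continuousOn : ∀ k, ContinuousOn (fun p : Sp d × Sp d => g (u k) p.1 p.2) (Ω ×ˢ Ω)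
  abs_le : ∀ k, ∀ x ∈ Ω, ∀ y ∈ Ω, |g (u k) x y| ≤ M
  nonneg : 0 ≤ M
  normConst_pos : 0 < normConst Ω g u

/-- The function `g v`, extended by zero from `Ω × Ω`. -/
def cutoff (Ω : Set (Sp d)) (g : 𝕏 → Sp d → Sp d → ℝ) (v : 𝕏) (x y : Sp d) : ℝ :=
  (Ω ×ˢ Ω).indicator (fun p : Sp d × Sp d => g v p.1 p.2) (x, y)

theorem cutoff_eq_indicator {x : Sp d} (hx : x ∈ Ω) (v : 𝕏) (y : Sp d) :
    cutoff Ω g v x y = Ω.indicator (g v x) y := by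
  by_cases hy : y ∈ Ω <;> simp [cutoff, hx, hy]

theorem cutoff_eq {x y : Sp d} (hx : x ∈ Ω) (hy : y ∈ Ω) (v : 𝕏) :
    cutoff Ω g v x y = g v x y := by
  simp [cutoff, hx, hy]

namespace IsAdmissible

variable (h : IsAdmissible Ω g u M)
include h

theorem measurableSet : MeasurableSet Ω := h.isOpen.measurableSet

theorem isFiniteMeasure : IsFiniteMeasure ((volume : Measure (Sp d)).restrict Ω) :=
  isFiniteMeasure_restrict.2 h.isBounded.measure_lt_top.ne

theorem isBoundedKernel (k : Fin N) : IsBoundedKernel Ω M (cutoff Ω g (u k)) where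
  measurable := by
    classical
    have := ((h.continuousOn k).measurable_piecewise (g := fun _ => (0 : ℝ))
      continuous_const.continuousOn (h.measurableSet.prod h.measurableSet))
    change Measurable ((Ω ×ˢ Ω).indicator fun p : Sp d × Sp d => g (u k) p.1 p.2)
    rw [← Set.piecewise_eq_indicator]
    exact this
  abs_le x y := by
    by_cases hxy : x ∈ Ω ∧ y ∈ Ω
    · rw [cutoff_eq hxy.1 hxy.2]
      exact h.abs_le k x hxy.1 y hxy.2
    · simpa [cutoff, hxy] using h.nonneg
  eq_zero x y hy := by simp [cutoff, hy]
  continuousOn x := by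
    by_cases hx : x ∈ Ω
    · refine ContinuousOn.congr (f := g (u k) x) ?_ fun y hy => cutoff_eq hx hy _
      exact (h.continuousOn k).comp (f := fun y => (x, y)) (by fun_prop) fun y hy => ⟨hx, hy⟩
    · exact (continuousOn_const (c := (0 : ℝ))).congr fun y _ => by simp [cutoff, hx]

theorem card_pos : 0 < (N : ℝ) := by
  rcases Nat.eq_zero_or_pos N with rfl | hN
  · have := h.normConst_pos
    simp [normConst] at this
  · exact_mod_cast hN

theorem const_pos : 0 < 1 / (normConst Ω g u * N) :=
  one_div_pos.2 (mul_pos h.normConst_pos h.card_pos)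

theorem integrable_abs_cutoff (k : Fin N) :
    Integrable (fun p : Sp d × Sp d => |cutoff Ω g (u k) p.1 p.2|)
      ((volume.restrict Ω).prod (volume.restrict Ω)) := by
  have := h.isFiniteMeasure
  exact Integrable.of_bound (C := M) (h.isBoundedKernel k).abs.measurable.aestronglyMeasurable
    (Eventually.of_forall fun p => (h.isBoundedKernel k).abs.abs_le _ _)

/-- The defining formula of the exploration measure, tested on nonnegative functions, with `g[uₖ]`
replaced by its measurable extension. -/
theorem lintegral_rho {f : ℝ → ENNReal} (hf : Measurable f) :
    ∫⁻ r, f r ∂rho Ω g u = ENNReal.ofReal (1 / (normConst Ω g u * N)) *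
      ∑ k, ∫⁻ p : Sp d × Sp d, f ‖p.2‖ * ENNReal.ofReal |cutoff Ω g (u k) p.1 p.2|
        ∂((volume.restrict Ω).prod (volume.restrict Ω)) := by
  have hm : ∀ k, Measurable fun p : Sp d × Sp d => ENNReal.ofReal |cutoff Ω g (u k) p.1 p.2| :=
    fun k => (h.isBoundedKernel k).abs.measurable.ennreal_ofReal
  have hg : ∀ k, (((volume : Measure (Sp d)).restrict Ω).prod (volume.restrict Ω)).withDensity
      (fun p => ENNReal.ofReal |g (u k) p.1 p.2|) =
      (((volume : Measure (Sp d)).restrict Ω).prod (volume.restrict Ω)).withDensity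
        fun p => ENNReal.ofReal |cutoff Ω g (u k) p.1 p.2| := by
    intro k
    refine withDensity_congr_ae ?_
    rw [Measure.prod_restrict]
    filter_upwards [ae_restrict_mem (h.measurableSet.prod h.measurableSet)] with p hp
    rw [cutoff_eq hp.1 hp.2]
  rw [rho, lintegral_smul_measure, lintegral_finsetSum_measure, smul_eq_mul]
  congr 1
  refine Finset.sum_congr rfl fun k _ => ?_
  rw [hg, lintegral_map hf (by fun_prop),
    lintegral_withDensity_eq_lintegral_mul _ (hm k) (by fun_prop)]
  simp only [Pi.mul_apply, mul_comm]

theorem sum_integral_abs_cutoff :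
    ∑ k, ∫ p : Sp d × Sp d, |cutoff Ω g (u k) p.1 p.2|
      ∂((volume.restrict Ω).prod (volume.restrict Ω)) = normConst Ω g u * N := by
  have := h.isFiniteMeasure
  have h1 : ∀ k, ∫ p : Sp d × Sp d, |cutoff Ω g (u k) p.1 p.2|
      ∂((volume.restrict Ω).prod (volume.restrict Ω)) =
      ∫ y in Ω, ∫ x in Ω, |g (u k) x y| := by
    intro k
    rw [integral_prod_symm _ (h.integrable_abs_cutoff k)]
    refine setIntegral_congr_fun h.measurableSet fun y hy => ?_
    refine setIntegral_congr_fun h.measurableSet fun x hx => ?_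
    simp only [cutoff_eq hx hy]
  simp only [h1, normConst]
  have := h.card_pos.ne'
  field_simp

theorem isProbabilityMeasure_rho : IsProbabilityMeasure (rho Ω g u) := by
  constructor
  have h1 := h.lintegral_rho (f := fun _ => 1) measurable_const
  simp only [lintegral_const, one_mul] at h1
  rw [h1]
  have h2 : ∀ k, ∫⁻ p : Sp d × Sp d, ENNReal.ofReal |cutoff Ω g (u k) p.1 p.2|
      ∂((volume.restrict Ω).prod (volume.restrict Ω)) = ENNReal.ofReal
      (∫ p : Sp d × Sp d, |cutoff Ω g (u k) p.1 p.2|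
        ∂((volume.restrict Ω).prod (volume.restrict Ω))) := fun k =>
    (ofReal_integral_eq_lintegral_ofReal (h.integrable_abs_cutoff k)
      (Eventually.of_forall fun p => abs_nonneg _)).symm
  simp only [h2]
  rw [← ENNReal.ofReal_sum_of_nonneg fun k _ => integral_nonneg fun p => abs_nonneg _,
    h.sum_integral_abs_cutoff, ← ENNReal.ofReal_mul h.const_pos.le,
    one_div_mul_cancel (mul_pos h.normConst_pos h.card_pos).ne', ENNReal.ofReal_one]

end IsAdmissible

/-- The density of the exploration measure with respect to `r^{d-1} dr`. -/
def radialWeight (Ω : Set (Sp d)) (g : 𝕏 → Sp d → Sp d → ℝ) (u : Fin N → 𝕏) (r : ℝ) : ℝ :=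
  (1 / (normConst Ω g u * N)) * ∑ k, ∫ x in Ω,
    sphereIntegral (fun x y => |cutoff Ω g (u k) x y|) r x

theorem integral_sphereIntegral_abs_nonneg (w : Sp d → Sp d → ℝ) (r : ℝ) :
    0 ≤ ∫ x in Ω, sphereIntegral (fun x y => |w x y|) r x :=
  integral_nonneg fun _ => integral_nonneg fun _ => abs_nonneg _

namespace IsAdmissible

variable (h : IsAdmissible Ω g u M)
include h

theorem measurable_integral_sphereIntegral {w : Sp d → Sp d → ℝ} (hw : IsBoundedKernel Ω M w) :
    Measurable fun r => ∫ x in Ω, sphereIntegral w r x := by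
  have := h.isFiniteMeasure
  exact (hw.measurable_sphereIntegral.stronglyMeasurable.integral_prod_right'
    (ν := volume.restrict Ω)).measurable

theorem integrable_sphereIntegral {w : Sp d → Sp d → ℝ} (hw : IsBoundedKernel Ω M w) (r : ℝ) :
    Integrable (sphereIntegral w r) (volume.restrict Ω) := by
  have := h.isFiniteMeasure
  refine Integrable.of_bound (C := M * (sphereMeasure d).real Set.univ)
    (hw.measurable_sphereIntegral.comp (f := fun x => (r, x)) (by fun_prop)).aestronglyMeasurable
    (Eventually.of_forall fun x => hw.abs_sphereIntegral_le _ _)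

theorem radialWeight_nonneg (r : ℝ) : 0 ≤ radialWeight Ω g u r :=
  mul_nonneg h.const_pos.le (Finset.sum_nonneg fun _ _ => integral_sphereIntegral_abs_nonneg _ r)

theorem measurable_radialWeight : Measurable (radialWeight Ω g u) := by
  refine Measurable.const_mul (Finset.measurable_fun_sum _ fun k _ => ?_) _
  exact h.measurable_integral_sphereIntegral (h.isBoundedKernel k).abs

theorem integrable_sphere_prod {w : Sp d → Sp d → ℝ} (hw : IsBoundedKernel Ω M w) (r : ℝ) :
    Integrable (fun p : Sp d × Metric.sphere (0 : Sp d) 1 => w p.1 (r • (p.2 : Sp d)))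
      ((volume.restrict Ω).prod (sphereMeasure d)) := by
  have := h.isFiniteMeasure
  exact Integrable.of_bound (C := M)
    (hw.measurable.comp (f := fun p : Sp d × Metric.sphere (0 : Sp d) 1 =>
      (p.1, r • (p.2 : Sp d))) (by fun_prop)).aestronglyMeasurable
    (Eventually.of_forall fun p => hw.abs_le _ _)

theorem rhoDensity_eq (r : ℝ) :
    rhoDensity Ω g u r = if 0 < r then r ^ (d - 1) * radialWeight Ω g u r else 0 := by
  have := h.isFiniteMeasure
  unfold rhoDensity
  split_ifs with hr
  · rw [radialWeight, mul_left_comm, Finset.mul_sum (s := Finset.univ) (a := r ^ (d - 1))]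
    congr 1
    refine Finset.sum_congr rfl fun k _ => ?_
    congr 1
    unfold sphereIntegral
    refine Eq.trans ?_
      (integral_integral_swap (h.integrable_sphere_prod (h.isBoundedKernel k).abs r)).symm
    refine integral_congr_ae (Eventually.of_forall fun ξ => ?_)
    refine setIntegral_congr_fun h.measurableSet fun x hx => ?_
    simp only [cutoff_eq_indicator hx]
    by_cases hy : r • (ξ : Sp d) ∈ Ω <;> simp [hy]
  · rfl

theorem ofReal_integral_sphereIntegral_abs (k : Fin N) (r : ℝ) :
    ENNReal.ofReal (∫ x in Ω, sphereIntegral (fun x y => |cutoff Ω g (u k) x y|) r x) =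
      ∫⁻ ξ, ∫⁻ x in Ω, ENNReal.ofReal |cutoff Ω g (u k) x (r • (ξ : Sp d))| ∂volume
        ∂sphereMeasure d := by
  have := h.isFiniteMeasure
  have hi := h.integrable_sphere_prod (h.isBoundedKernel k).abs r
  unfold sphereIntegral
  rw [← integral_prod _ hi, ofReal_integral_eq_lintegral_ofReal hi
    (Eventually.of_forall fun p => abs_nonneg _),
    lintegral_prod_symm _ hi.1.aemeasurable.ennreal_ofReal]

theorem rho_eq_withDensity_radialMeasure :
    rho Ω g u = (radialMeasure d).withDensity fun r => ENNReal.ofReal (radialWeight Ω g u r) := by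
  have := h.isFiniteMeasure
  refine Measure.ext_of_lintegral _ fun f hf => ?_
  rw [h.lintegral_rho hf, lintegral_withDensity_eq_lintegral_mul _
    h.measurable_radialWeight.ennreal_ofReal hf]
  have hm : ∀ k, Measurable fun p : Sp d × Sp d => ENNReal.ofReal |cutoff Ω g (u k) p.1 p.2| :=
    fun k => (h.isBoundedKernel k).abs.measurable.ennreal_ofReal
  have hterm : ∀ k, ∫⁻ p : Sp d × Sp d, f ‖p.2‖ * ENNReal.ofReal |cutoff Ω g (u k) p.1 p.2|
        ∂((volume.restrict Ω).prod (volume.restrict Ω)) =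
      ∫⁻ r, f r * ENNReal.ofReal (∫ x in Ω,
        sphereIntegral (fun x y => |cutoff Ω g (u k) x y|) r x) ∂radialMeasure d := by
    intro k
    have hm1 : Measurable fun p : Sp d × Sp d =>
        f ‖p.2‖ * ENNReal.ofReal |cutoff Ω g (u k) p.1 p.2| := by
      have := hm k
      fun_prop
    rw [lintegral_prod_symm _ hm1.aemeasurable]
    have h1 : ∫⁻ y in Ω, ∫⁻ x in Ω, f ‖y‖ * ENNReal.ofReal |cutoff Ω g (u k) x y| =
        ∫⁻ y, ∫⁻ x in Ω, f ‖y‖ * ENNReal.ofReal |cutoff Ω g (u k) x y| := by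
      rw [← lintegral_indicator h.measurableSet]
      refine lintegral_congr fun y => ?_
      by_cases hy : y ∈ Ω
      · simp [hy]
      · simp [hy, (h.isBoundedKernel k).eq_zero _ y hy]
    rw [h1, lintegral_polar h.pos (Measurable.lintegral_prod_left' hm1)]
    refine lintegral_congr_ae ?_
    filter_upwards [ae_pos_radialMeasure] with r hr
    have hm2 : Measurable fun q : Metric.sphere (0 : Sp d) 1 × Sp d =>
        ENNReal.ofReal |cutoff Ω g (u k) q.2 (r • (q.1 : Sp d))| :=
      (hm k).comp (f := fun q : Metric.sphere (0 : Sp d) 1 × Sp d => (q.2, r • (q.1 : Sp d)))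
        (by fun_prop)
    rw [h.ofReal_integral_sphereIntegral_abs, ← lintegral_const_mul _
      (Measurable.lintegral_prod_right' hm2)]
    refine lintegral_congr fun ξ => ?_
    rw [norm_smul_sphere hr, lintegral_const_mul]
    exact hm2.comp (f := fun x => (ξ, x)) (by fun_prop)
  simp only [hterm]
  rw [← lintegral_finsetSum' _ fun k _ => ?_, ← lintegral_const_mul' _ _ ENNReal.ofReal_ne_top]
  · refine lintegral_congr fun r => ?_
    rw [← Finset.mul_sum, Pi.mul_apply, radialWeight, ENNReal.ofReal_mul h.const_pos.le,
      ENNReal.ofReal_sum_of_nonneg fun k _ => integral_sphereIntegral_abs_nonneg _ r]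
    ring
  · have := h.measurable_integral_sphereIntegral (h.isBoundedKernel k).abs
    exact (hf.mul this.ennreal_ofReal).aemeasurable

theorem measurable_rhoDensity : Measurable (rhoDensity Ω g u) := by
  have h1 := h.measurable_radialWeight
  have h2 : rhoDensity Ω g u =
      fun r => if 0 < r then r ^ (d - 1) * radialWeight Ω g u r else 0 := by
    funext r
    exact h.rhoDensity_eq r
  rw [h2]
  exact Measurable.ite measurableSet_Ioi (by fun_prop) measurable_const

theorem rho_eq_withDensity :
    rho Ω g u = volume.withDensity fun r => ENNReal.ofReal (rhoDensity Ω g u r) := by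
  refine Measure.ext_of_lintegral _ fun f hf => ?_
  have hm := h.measurable_rhoDensity
  rw [h.rho_eq_withDensity_radialMeasure, lintegral_withDensity_eq_lintegral_mul _
    h.measurable_radialWeight.ennreal_ofReal hf, lintegral_radialMeasure
    (h.measurable_radialWeight.ennreal_ofReal.mul hf), lintegral_withDensity_eq_lintegral_mul _
    hm.ennreal_ofReal hf, ← lintegral_indicator measurableSet_Ioi]
  refine lintegral_congr fun r => ?_
  by_cases hr : 0 < r
  · rw [Set.indicator_of_mem (Set.mem_Ioi.2 hr), Pi.mul_apply, Pi.mul_apply, h.rhoDensity_eq,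
      if_pos hr, ENNReal.ofReal_mul (by positivity), mul_assoc]
  · rw [Set.indicator_of_notMem (by simpa using hr), Pi.mul_apply, h.rhoDensity_eq, if_neg hr]
    simp

end IsAdmissible

end Exploration


/-! ### The feature maps of the reweighted kernel -/

section Features

variable {d N : ℕ} {𝕏 : Type*} {Ω : Set (Sp d)} {g : 𝕏 → Sp d → Sp d → ℝ} {u : Fin N → 𝕏} {M : ℝ}

/-- The square of an integral against a finite measure, by the Cauchy-Schwarz inequality. -/
theorem sq_integral_le {X : Type*} [MeasurableSpace X] {μ : Measure X} [IsFiniteMeasure μ]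
    {f : X → ℝ} (hf : MemLp f 2 μ) : (∫ x, f x ∂μ) ^ 2 ≤ μ.real Set.univ * ∫ x, f x ^ 2 ∂μ := by
  have h1 : Integrable f μ := hf.integrable one_le_two
  have h2 : Integrable (fun x => f x ^ 2) μ := hf.integrable_sq
  set m := μ.real Set.univ with hm
  have hm0 : 0 ≤ m := measureReal_nonneg
  rcases hm0.eq_or_lt with h0 | h0
  · have : μ = 0 := by
      rw [← Measure.measure_univ_eq_zero]
      exact (measureReal_eq_zero_iff (measure_ne_top _ _)).1 h0.symm
    simp [this]
  · set I := ∫ x, f x ∂μ with hI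
    have h3 : 0 ≤ ∫ x, (m * f x - I) ^ 2 ∂μ := integral_nonneg fun x => sq_nonneg _
    have h4 : ∫ x, (m * f x - I) ^ 2 ∂μ =
        m ^ 2 * (∫ x, f x ^ 2 ∂μ) - 2 * m * I * I + m * I ^ 2 := by
      have h5 : ∀ x, (m * f x - I) ^ 2 = m ^ 2 * f x ^ 2 - 2 * m * I * f x + I ^ 2 := fun x => by
        ring
      simp only [h5]
      have h6 : Integrable (fun x => m ^ 2 * f x ^ 2 - 2 * m * I * f x) μ :=
        (h2.const_mul _).sub (h1.const_mul _)
      rw [integral_add h6 (integrable_const _),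
        integral_sub (h2.const_mul _) (h1.const_mul _), integral_const_mul, integral_const_mul,
        integral_const, smul_eq_mul]
    rw [h4] at h3
    by_contra hlt
    push Not at hlt
    nlinarith

/-- The integral of `g[uₖ](x, ·)` over the sphere of radius `r`, divided by the density of the
exploration measure (relative to `r^{d-1} dr`). -/
def featureFun (Ω : Set (Sp d)) (g : 𝕏 → Sp d → Sp d → ℝ) (u : Fin N → 𝕏) (k : Fin N) (r : ℝ)
    (x : Sp d) : ℝ :=
  if 0 < r then sphereIntegral (cutoff Ω g (u k)) r x / radialWeight Ω g u r else 0

namespace IsAdmissible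

variable (h : IsAdmissible Ω g u M)
include h

theorem measurable_featureFun (k : Fin N) :
    Measurable fun p : ℝ × Sp d => featureFun Ω g u k p.1 p.2 := by
  have h1 := (h.isBoundedKernel k).measurable_sphereIntegral
  have h2 := h.measurable_radialWeight
  exact Measurable.ite (measurable_fst measurableSet_Ioi) (h1.div (h2.comp measurable_fst))
    measurable_const

theorem memLp_featureFun (k : Fin N) (r : ℝ) :
    MemLp (featureFun Ω g u k r) 2 (volume.restrict Ω) := by
  have := h.isFiniteMeasure
  refine MemLp.of_bound (((h.measurable_featureFun k).comp (f := fun x => (r, x))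
    (by fun_prop)).aestronglyMeasurable)
    (M * (sphereMeasure d).real Set.univ / radialWeight Ω g u r)
    (Eventually.of_forall fun x => ?_)
  have hw := h.radialWeight_nonneg r
  have hb := (h.isBoundedKernel k).abs_sphereIntegral_le r x
  have hb0 := (abs_nonneg _).trans hb
  unfold featureFun
  split_ifs
  · rw [Real.norm_eq_abs, abs_div, abs_of_nonneg hw]
    gcongr
  · rw [norm_zero]
    positivity

/-- The feature map `r ↦ Φₖ(r) ∈ L²(Ω)` whose Gram kernels sum up to `Ḡ`. -/
def feature (k : Fin N) (r : ℝ) : Lp ℝ 2 ((volume : Measure (Sp d)).restrict Ω) :=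
  (h.memLp_featureFun k r).toLp _

theorem inner_feature (k : Fin N) (r : ℝ) (f : Lp ℝ 2 ((volume : Measure (Sp d)).restrict Ω)) :
    ⟪h.feature k r, f⟫_ℝ = ∫ x in Ω, featureFun Ω g u k r x * f x := by
  rw [L2.inner_def]
  refine integral_congr_ae ?_
  filter_upwards [(h.memLp_featureFun k r).coeFn_toLp] with x hx
  rw [feature, hx]
  simp [mul_comm]

theorem inner_feature_feature (k : Fin N) (r s : ℝ) :
    ⟪h.feature k r, h.feature k s⟫_ℝ =
      ∫ x in Ω, featureFun Ω g u k r x * featureFun Ω g u k s x := by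
  rw [h.inner_feature]
  refine integral_congr_ae ?_
  filter_upwards [(h.memLp_featureFun k s).coeFn_toLp] with x hx
  rw [feature, hx]

theorem integral_sphereIntegral_mul (k : Fin N) (r s : ℝ) :
    ∫ η, (∫ ξ, (∫ x in Ω, Ω.indicator (g (u k) x) (r • (ξ : Sp d)) *
        Ω.indicator (g (u k) x) (s • (η : Sp d))) ∂(sphereMeasure d)) ∂(sphereMeasure d) =
      ∫ x in Ω, sphereIntegral (cutoff Ω g (u k)) r x *
        sphereIntegral (cutoff Ω g (u k)) s x := by
  have := h.isFiniteMeasure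
  have hw := h.isBoundedKernel k
  have h1 : ∀ η : Metric.sphere (0 : Sp d) 1,
      ∫ ξ, (∫ x in Ω, Ω.indicator (g (u k) x) (r • (ξ : Sp d)) *
        Ω.indicator (g (u k) x) (s • (η : Sp d))) ∂(sphereMeasure d) =
      ∫ x in Ω, sphereIntegral (cutoff Ω g (u k)) r x * cutoff Ω g (u k) x (s • (η : Sp d)) := by
    intro η
    simp only [sphereIntegral, ← integral_mul_const]
    refine Eq.trans ?_ (integral_integral_swap ?_).symm
    · refine integral_congr_ae (Eventually.of_forall fun ξ => ?_)
      refine setIntegral_congr_fun h.measurableSet fun x hx => ?_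
      simp only [cutoff_eq_indicator hx]
    · refine Integrable.of_bound (C := M * M) (Measurable.aestronglyMeasurable ?_)
        (Eventually.of_forall fun p => ?_)
      · exact (hw.measurable.comp (f := fun p : Sp d × Metric.sphere (0 : Sp d) 1 =>
          (p.1, r • (p.2 : Sp d))) (by fun_prop)).mul
          (hw.measurable.comp (f := fun p : Sp d × Metric.sphere (0 : Sp d) 1 =>
          (p.1, s • (η : Sp d))) (by fun_prop))
      · simp only [Function.uncurry, norm_mul, Real.norm_eq_abs]
        exact mul_le_mul (hw.abs_le _ _) (hw.abs_le _ _) (abs_nonneg _) h.nonneg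
  simp only [h1]
  rw [integral_integral_swap]
  · simp only [sphereIntegral, integral_const_mul]
  · refine Integrable.of_bound (C := (M * (sphereMeasure d).real Set.univ) * M)
      (Measurable.aestronglyMeasurable ?_) (Eventually.of_forall fun p => ?_)
    · exact (hw.measurable_sphereIntegral.comp
        (f := fun p : Metric.sphere (0 : Sp d) 1 × Sp d => (r, p.2)) (by fun_prop)).mul
        (hw.measurable.comp (f := fun p : Metric.sphere (0 : Sp d) 1 × Sp d =>
          (p.2, s • (p.1 : Sp d))) (by fun_prop))
    · simp only [Function.uncurry, norm_mul, Real.norm_eq_abs]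
      have hb := hw.abs_sphereIntegral_le r p.2
      exact mul_le_mul hb (hw.abs_le _ _) (abs_nonneg _) ((abs_nonneg _).trans hb)

theorem rhoDensity_pos_iff (r : ℝ) :
    0 < rhoDensity Ω g u r ↔ 0 < r ∧ 0 < radialWeight Ω g u r := by
  rw [h.rhoDensity_eq]
  split_ifs with hr
  · simp [hr, mul_pos_iff_of_pos_left (pow_pos hr (d - 1))]
  · simp [hr]

theorem kerGbar_eq (r s : ℝ) : kerGbar Ω g u r s = (1 / (N : ℝ)) * ∑ k,
    ⟪h.feature k r, h.feature k s⟫_ℝ := by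
  simp only [h.inner_feature_feature]
  unfold kerGbar featureFun
  split_ifs with hrs hr hs hs
  · have hr' := (h.rhoDensity_pos_iff r).1 hrs.1
    have hs' := (h.rhoDensity_pos_iff s).1 hrs.2
    rw [kerG, if_pos ⟨hr, hs⟩, h.rhoDensity_eq, h.rhoDensity_eq, if_pos hr, if_pos hs,
      mul_div_assoc, Finset.sum_div]
    congr 1
    refine Finset.sum_congr rfl fun k _ => ?_
    rw [h.integral_sphereIntegral_mul]
    have hr0 := hr'.2.ne'
    have hs0 := hs'.2.ne'
    simp only [div_mul_div_comm, integral_div]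
    field_simp
  · exact absurd ((h.rhoDensity_pos_iff s).1 hrs.2).1 hs
  · exact absurd ((h.rhoDensity_pos_iff r).1 hrs.1).1 hr
  · exact absurd ((h.rhoDensity_pos_iff r).1 hrs.1).1 hr
  · have hz : radialWeight Ω g u r = 0 ∨ radialWeight Ω g u s = 0 := by
      by_contra hne
      push Not at hne
      exact hrs ⟨(h.rhoDensity_pos_iff r).2 ⟨‹_›, (h.radialWeight_nonneg r).lt_of_ne' hne.1⟩,
        (h.rhoDensity_pos_iff s).2 ⟨‹_›, (h.radialWeight_nonneg s).lt_of_ne' hne.2⟩⟩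
    rcases hz with hz | hz <;> simp [hz]
  all_goals simp

theorem measurable_inner_feature_feature (k : Fin N) (s : ℝ) :
    Measurable fun r => ⟪h.feature k r, h.feature k s⟫_ℝ := by
  have := h.isFiniteMeasure
  simp only [h.inner_feature_feature]
  have hm : Measurable fun p : ℝ × Sp d => featureFun Ω g u k p.1 p.2 * featureFun Ω g u k s p.2 :=
    (h.measurable_featureFun k).mul ((h.measurable_featureFun k).comp
      (f := fun p : ℝ × Sp d => (s, p.2)) (by fun_prop))
  exact (hm.stronglyMeasurable.integral_prod_right' (ν := volume.restrict Ω)).measurable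

theorem measurable_norm_feature_sq (k : Fin N) : Measurable fun r => ‖h.feature k r‖ ^ 2 := by
  have := h.isFiniteMeasure
  simp only [← real_inner_self_eq_norm_sq, h.inner_feature_feature]
  have hm : Measurable fun p : ℝ × Sp d =>
      featureFun Ω g u k p.1 p.2 * featureFun Ω g u k p.1 p.2 :=
    (h.measurable_featureFun k).mul (h.measurable_featureFun k)
  exact (hm.stronglyMeasurable.integral_prod_right' (ν := volume.restrict Ω)).measurable

theorem integral_sphereIntegral_abs_le (k : Fin N) (r : ℝ) :
    ∫ x in Ω, sphereIntegral (fun x y => |cutoff Ω g (u k) x y|) r x ≤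
      normConst Ω g u * N * radialWeight Ω g u r := by
  have h0 := (mul_pos h.normConst_pos h.card_pos).ne'
  rw [radialWeight, ← mul_assoc, mul_one_div_cancel h0, one_mul]
  exact Finset.single_le_sum
    (f := fun k => ∫ x in Ω, sphereIntegral (fun x y => |cutoff Ω g (u k) x y|) r x)
    (fun k _ => integral_sphereIntegral_abs_nonneg _ r) (Finset.mem_univ k)

/-- One factor of `(∫ g)²` is bounded by a constant; the other is dominated by the density
itself. -/
theorem radialWeight_mul_norm_feature_sq_le (k : Fin N) (r : ℝ) :
    radialWeight Ω g u r * ‖h.feature k r‖ ^ 2 ≤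
      M * (sphereMeasure d).real Set.univ * (normConst Ω g u * N) := by
  have := h.isFiniteMeasure
  have hw := h.isBoundedKernel k
  have hZ := mul_pos h.normConst_pos h.card_pos
  have hS : 0 ≤ M * (sphereMeasure d).real Set.univ := mul_nonneg h.nonneg measureReal_nonneg
  rw [← real_inner_self_eq_norm_sq, h.inner_feature_feature]
  unfold featureFun
  split_ifs with hr
  · rcases (h.radialWeight_nonneg r).eq_or_lt with h0 | h0
    · rw [← h0, zero_mul]
      positivity
    simp only [div_mul_div_comm, integral_div]
    have hJ : ∫ x in Ω, sphereIntegral (cutoff Ω g (u k)) r x *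
        sphereIntegral (cutoff Ω g (u k)) r x ≤
        M * (sphereMeasure d).real Set.univ * (normConst Ω g u * N * radialWeight Ω g u r) := by
      refine le_trans ?_ (mul_le_mul_of_nonneg_left (h.integral_sphereIntegral_abs_le k r) hS)
      rw [← integral_const_mul]
      refine integral_mono_of_nonneg (Eventually.of_forall fun x => mul_self_nonneg _)
        ((h.integrable_sphereIntegral hw.abs r).const_mul _) (Eventually.of_forall fun x => ?_)
      simp only
      rw [← abs_mul_abs_self]
      exact mul_le_mul (hw.abs_sphereIntegral_le r x)
        (abs_sphereIntegral_le_sphereIntegral_abs r x) (abs_nonneg _) hS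
    rw [← mul_div_assoc, div_le_iff₀ (mul_pos h0 h0)]
    nlinarith [mul_le_mul_of_nonneg_left hJ h0.le]
  · simp only [mul_zero, integral_zero]
    positivity

theorem integrable_norm_feature_sq (k : Fin N) :
    Integrable (fun r => ‖h.feature k r‖ ^ 2) (rho Ω g u) := by
  obtain ⟨R, hR0, hR⟩ := h.isBounded.subset_ball_lt 0 0
  rw [h.rho_eq_withDensity_radialMeasure, integrable_withDensity_iff_integrable_smul'
    h.measurable_radialWeight.ennreal_ofReal (Eventually.of_forall fun _ => ENNReal.ofReal_lt_top)]
  set C := M * (sphereMeasure d).real Set.univ * (normConst Ω g u * N)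
  have hint : Integrable ((Set.Iio R).indicator fun _ => C) (radialMeasure d) :=
    (integrable_indicator_iff measurableSet_Iio).2
      (integrableOn_const (radialMeasure_Iio_lt_top R).ne)
  refine hint.mono' ?_ ?_
  · have h1 := h.measurable_radialWeight
    have h2 := h.measurable_norm_feature_sq k
    exact (h1.ennreal_ofReal.ennreal_toReal.smul h2).aestronglyMeasurable
  · filter_upwards [ae_pos_radialMeasure] with r hr
    rw [ENNReal.toReal_ofReal (h.radialWeight_nonneg r), smul_eq_mul, Real.norm_of_nonneg
      (mul_nonneg (h.radialWeight_nonneg r) (sq_nonneg _))]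
    by_cases hrR : r < R
    · rw [Set.indicator_of_mem (Set.mem_Iio.2 hrR)]
      exact h.radialWeight_mul_norm_feature_sq_le k r
    · rw [Set.indicator_of_notMem (by simpa using hrR)]
      have hz : radialWeight Ω g u r = 0 := by
        have : ∀ y ∈ Ω, ‖y‖ ≠ r := fun y hy => by
          have := mem_ball_zero_iff.1 (hR hy)
          linarith
        simp [radialWeight, (h.isBoundedKernel _).abs.sphereIntegral_eq_zero hr this]
      rw [hz, zero_mul]

theorem exists_isAnalysisOperator_feature (k : Fin N) :
    ∃ B, IsAnalysisOperator (rho Ω g u) (h.feature k) B :=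
  exists_isAnalysisOperator (fun f => (measurable_inner_of_measurable_kernel
    (h.measurable_inner_feature_feature k) f).aestronglyMeasurable)
    (h.integrable_norm_feature_sq k)

end IsAdmissible

end Features


/-! ### The adjoint of the feature operator -/

section Synthesis

variable {d N : ℕ} {𝕏 : Type*} {Ω : Set (Sp d)} {g : 𝕏 → Sp d → Sp d → ℝ} {u : Fin N → 𝕏} {M : ℝ}

namespace IsAdmissible

variable (h : IsAdmissible Ω g u M)
include h

theorem lintegral_prod_cutoff_lt_top {f : ℝ → ENNReal} (hf : Measurable f)
    (hfi : ∫⁻ r, f r ∂rho Ω g u < ⊤) (k : Fin N) :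
    ∫⁻ p : Sp d × Sp d, f ‖p.2‖ * ENNReal.ofReal |cutoff Ω g (u k) p.1 p.2|
        ∂((volume.restrict Ω).prod (volume.restrict Ω)) < ⊤ := by
  rw [h.lintegral_rho hf] at hfi
  have h0 : ENNReal.ofReal (1 / (normConst Ω g u * N)) ≠ 0 :=
    (ENNReal.ofReal_pos.2 h.const_pos).ne'
  have := ENNReal.lt_top_of_mul_ne_top_right hfi.ne h0
  exact (ENNReal.sum_lt_top.1 this) k (Finset.mem_univ k)

theorem integral_rho (f : ℝ → ℝ) :
    ∫ r, f r ∂rho Ω g u = ∫ r, radialWeight Ω g u r * f r ∂radialMeasure d := by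
  rw [h.rho_eq_withDensity_radialMeasure, integral_withDensity_eq_integral_toReal_smul
    h.measurable_radialWeight.ennreal_ofReal (Eventually.of_forall fun _ => ENNReal.ofReal_lt_top)]
  simp only [ENNReal.toReal_ofReal (h.radialWeight_nonneg _), smul_eq_mul]

/-- What holds `ρ`-almost everywhere holds at `‖y‖` for almost every `(x, y) ∈ Ω × Ω` at which
`g[uₖ]` does not vanish. -/
theorem ae_prod_of_ae_rho {P : ℝ → Prop} (hP : ∀ᵐ r ∂rho Ω g u, P r) (k : Fin N) :
    ∀ᵐ p : Sp d × Sp d ∂((volume.restrict Ω).prod (volume.restrict Ω)),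
      cutoff Ω g (u k) p.1 p.2 = 0 ∨ P ‖p.2‖ := by
  let E : Set ℝ := toMeasurable (rho Ω g u) {r | ¬ P r}
  have hE : MeasurableSet E := measurableSet_toMeasurable _ _
  have hE0 : rho Ω g u E = 0 := (measure_toMeasurable _).trans hP
  have hEi : Measurable (E.indicator fun _ => (1 : ENNReal)) := measurable_const.indicator hE
  have h1 := h.lintegral_rho hEi
  rw [lintegral_indicator_const hE, hE0, mul_zero, eq_comm, mul_eq_zero] at h1
  have h0 : ENNReal.ofReal (1 / (normConst Ω g u * N)) ≠ 0 :=
    (ENNReal.ofReal_pos.2 h.const_pos).ne'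
  have h2 := (Finset.sum_eq_zero_iff.1 (h1.resolve_left h0)) k (Finset.mem_univ k)
  have hm : Measurable fun p : Sp d × Sp d => ENNReal.ofReal |cutoff Ω g (u k) p.1 p.2| :=
    (h.isBoundedKernel k).abs.measurable.ennreal_ofReal
  have hEm : Measurable fun p : Sp d × Sp d => E.indicator (fun _ => (1 : ENNReal)) ‖p.2‖ *
      ENNReal.ofReal |cutoff Ω g (u k) p.1 p.2| :=
    (hEi.comp (by fun_prop : Measurable fun p : Sp d × Sp d => ‖p.2‖)).mul hm
  rw [lintegral_eq_zero_iff hEm] at h2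
  filter_upwards [h2] with p hp
  by_cases hpE : ‖p.2‖ ∈ E
  · left
    simpa [hpE] using hp
  · right
    by_contra hn
    exact hpE (subset_toMeasurable _ _ hn)

theorem integrable_sq_mul_abs_cutoff (φ : Lp ℝ 2 (rho Ω g u)) (k : Fin N) :
    Integrable (fun p : Sp d × Sp d => φ ‖p.2‖ ^ 2 * |cutoff Ω g (u k) p.1 p.2|)
      ((volume.restrict Ω).prod (volume.restrict Ω)) := by
  have hφ : Measurable φ := (Lp.stronglyMeasurable φ).measurable
  have hφ2 : Integrable (fun r => φ r ^ 2) (rho Ω g u) := (Lp.memLp φ).integrable_sq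
  have hm := (h.isBoundedKernel k).abs.measurable
  refine ⟨Measurable.aestronglyMeasurable (by fun_prop), ?_⟩
  have hfi : ∫⁻ r, ENNReal.ofReal (φ r ^ 2) ∂rho Ω g u < ⊤ :=
    (hasFiniteIntegral_iff_ofReal (Eventually.of_forall fun r => sq_nonneg _)).1 hφ2.2
  rw [hasFiniteIntegral_iff_ofReal (Eventually.of_forall fun p => by positivity)]
  refine lt_of_eq_of_lt (lintegral_congr fun p => ?_)
    (h.lintegral_prod_cutoff_lt_top (f := fun r => ENNReal.ofReal (φ r ^ 2)) (by fun_prop) hfi k)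
  rw [ENNReal.ofReal_mul (sq_nonneg _)]

theorem integrable_sq_mul_cutoff_sq (φ : Lp ℝ 2 (rho Ω g u)) (k : Fin N) :
    Integrable (fun p : Sp d × Sp d => (φ ‖p.2‖ * cutoff Ω g (u k) p.1 p.2) ^ 2)
      ((volume.restrict Ω).prod (volume.restrict Ω)) := by
  have hφ : Measurable φ := (Lp.stronglyMeasurable φ).measurable
  have hm := (h.isBoundedKernel k).measurable
  refine ((h.integrable_sq_mul_abs_cutoff φ k).const_mul M).mono'
    (Measurable.aestronglyMeasurable (by fun_prop)) (Eventually.of_forall fun p => ?_)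
  rw [Real.norm_of_nonneg (sq_nonneg _), mul_pow, ← sq_abs (cutoff _ _ _ _ _)]
  have hb := (h.isBoundedKernel k).abs_le p.1 p.2
  nlinarith [mul_le_mul_of_nonneg_left (mul_le_mul_of_nonneg_right hb
    (abs_nonneg (cutoff Ω g (u k) p.1 p.2))) (sq_nonneg (φ ‖p.2‖))]

theorem memLp_mul_cutoff (φ : Lp ℝ 2 (rho Ω g u)) (k : Fin N) :
    MemLp (fun p : Sp d × Sp d => φ ‖p.2‖ * cutoff Ω g (u k) p.1 p.2) 2
      ((volume.restrict Ω).prod (volume.restrict Ω)) := by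
  have hφ : Measurable φ := (Lp.stronglyMeasurable φ).measurable
  have hm := (h.isBoundedKernel k).measurable
  exact (memLp_two_iff_integrable_sq (Measurable.aestronglyMeasurable (by fun_prop))).2
    (h.integrable_sq_mul_cutoff_sq φ k)

theorem opR_eq {x : Sp d} (hx : x ∈ Ω) (φ : ℝ → ℝ) (k : Fin N) :
    opR Ω g φ (u k) x = ∫ y in Ω, φ ‖y‖ * cutoff Ω g (u k) x y := by
  refine setIntegral_congr_fun h.measurableSet fun y hy => ?_
  simp only [cutoff_eq hx hy]

theorem ae_integrableOn (φ : Lp ℝ 2 (rho Ω g u)) (k : Fin N) :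
    ∀ᵐ x ∂(volume.restrict Ω), IntegrableOn (fun y => φ ‖y‖ * g (u k) x y) Ω := by
  have := h.isFiniteMeasure
  have hi := ((h.memLp_mul_cutoff φ k).integrable one_le_two).prod_right_ae
  filter_upwards [hi, ae_restrict_mem h.measurableSet] with x hx hxΩ
  refine IntegrableOn.congr_fun hx (fun y hy => ?_) h.measurableSet
  simp only [cutoff_eq hxΩ hy]

theorem memLp_opR (φ : Lp ℝ 2 (rho Ω g u)) (k : Fin N) :
    MemLp (opR Ω g φ (u k)) 2 (volume.restrict Ω) := by
  have := h.isFiniteMeasure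
  have hφ : Measurable φ := (Lp.stronglyMeasurable φ).measurable
  have hm := (h.isBoundedKernel k).measurable
  have hF : Measurable fun p : Sp d × Sp d => φ ‖p.2‖ * cutoff Ω g (u k) p.1 p.2 := by fun_prop
  have hsm : StronglyMeasurable fun x => ∫ y in Ω, φ ‖y‖ * cutoff Ω g (u k) x y :=
    hF.stronglyMeasurable.integral_prod_right'
  have hae : (fun x => ∫ y in Ω, φ ‖y‖ * cutoff Ω g (u k) x y) =ᵐ[volume.restrict Ω]
      opR Ω g φ (u k) := by
    filter_upwards [ae_restrict_mem h.measurableSet] with x hx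
    rw [h.opR_eq hx]
  refine MemLp.ae_eq hae ?_
  rw [memLp_two_iff_integrable_sq hsm.aestronglyMeasurable]
  have hi := h.integrable_sq_mul_cutoff_sq φ k
  refine (hi.integral_prod_left.const_mul
    (((volume : Measure (Sp d)).restrict Ω).real Set.univ)).mono'
    (hsm.pow 2).aestronglyMeasurable ?_
  filter_upwards [hi.prod_right_ae] with x hx
  rw [Real.norm_of_nonneg (sq_nonneg _)]
  refine sq_integral_le ((memLp_two_iff_integrable_sq ?_).2 hx)
  exact (hF.comp (f := fun y => (x, y)) (by fun_prop)).aestronglyMeasurable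

theorem opR_ae_eq {φ ψ : ℝ → ℝ} (hφψ : φ =ᵐ[rho Ω g u] ψ) (k : Fin N) :
    opR Ω g φ (u k) =ᵐ[volume.restrict Ω] opR Ω g ψ (u k) := by
  have := Measure.ae_ae_of_ae_prod (h.ae_prod_of_ae_rho hφψ k)
  filter_upwards [this, ae_restrict_mem h.measurableSet] with x hx hxΩ
  rw [h.opR_eq hxΩ, h.opR_eq hxΩ]
  refine integral_congr_ae ?_
  filter_upwards [hx] with y hy
  rcases hy with hy | hy
  · simp [hy]
  · simp only [hy]

theorem bilin_congr {φ ψ φ' ψ' : ℝ → ℝ} (hφ : φ =ᵐ[rho Ω g u] φ') (hψ : ψ =ᵐ[rho Ω g u] ψ') :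
    bilin Ω g u φ ψ = bilin Ω g u φ' ψ' := by
  unfold bilin
  congr 1
  refine Finset.sum_congr rfl fun k _ => integral_congr_ae ?_
  filter_upwards [h.opR_ae_eq hφ k, h.opR_ae_eq hψ k] with x h1 h2
  rw [h1, h2]

/-- Where the density of the exploration measure vanishes, so do the sphere integrals. -/
theorem radialWeight_mul_inner_feature {r : ℝ} (hr : 0 < r) (k : Fin N)
    (f : Lp ℝ 2 ((volume : Measure (Sp d)).restrict Ω)) :
    radialWeight Ω g u r * ⟪h.feature k r, f⟫_ℝ =
      ∫ x in Ω, sphereIntegral (cutoff Ω g (u k)) r x * f x := by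
  rw [h.inner_feature]
  simp only [featureFun, if_pos hr]
  rcases (h.radialWeight_nonneg r).eq_or_lt with h0 | h0
  · have hz : ∫ x in Ω, sphereIntegral (fun x y => |cutoff Ω g (u k) x y|) r x = 0 :=
      le_antisymm (by simpa [← h0] using h.integral_sphereIntegral_abs_le k r)
        (integral_sphereIntegral_abs_nonneg _ r)
    have hnn : 0 ≤ sphereIntegral (fun x y => |cutoff Ω g (u k) x y|) r := fun x =>
      integral_nonneg fun ξ => abs_nonneg _
    rw [integral_eq_zero_iff_of_nonneg hnn
      (h.integrable_sphereIntegral (h.isBoundedKernel k).abs r)] at hz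
    rw [← h0, zero_mul, eq_comm]
    refine integral_eq_zero_of_ae ?_
    filter_upwards [hz] with x hx
    have h1 := abs_sphereIntegral_le_sphereIntegral_abs (w := cutoff Ω g (u k)) r x
    rw [hx] at h1
    rw [abs_nonpos_iff.1 h1]
    simp
  · rw [← integral_const_mul]
    congr 1
    funext x
    field_simp

/-- The operator `φ ↦ R_φ[uₖ]` is adjoint to the operator with feature map `Φₖ`: Fubini's theorem,
in polar coordinates. -/
theorem integral_opR_mul (φ : Lp ℝ 2 (rho Ω g u)) (k : Fin N)
    (f : Lp ℝ 2 ((volume : Measure (Sp d)).restrict Ω)) :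
    ∫ x in Ω, opR Ω g φ (u k) x * f x = ∫ r, φ r * ⟪h.feature k r, f⟫_ℝ ∂rho Ω g u := by
  have := h.isFiniteMeasure
  have hw := h.isBoundedKernel k
  have hm := hw.measurable
  have hφ : Measurable φ := (Lp.stronglyMeasurable φ).measurable
  have hf : Measurable f := (Lp.stronglyMeasurable f).measurable
  have hfi : Integrable f (volume.restrict Ω) := (Lp.memLp f).integrable one_le_two
  have hF : Integrable (fun p : Sp d × Sp d => φ ‖p.2‖ * cutoff Ω g (u k) p.1 p.2 * f p.1)
      ((volume.restrict Ω).prod (volume.restrict Ω)) :=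
    (h.memLp_mul_cutoff φ k).integrable_mul ((Lp.memLp f).comp_fst _)
  -- `T y` is the inner integral over `x`
  let T : Sp d → ℝ := fun y => ∫ x in Ω, cutoff Ω g (u k) x y * f x
  have h1 : ∫ x in Ω, opR Ω g φ (u k) x * f x = ∫ y in Ω, φ ‖y‖ * T y := by
    calc ∫ x in Ω, opR Ω g φ (u k) x * f x
        = ∫ x in Ω, ∫ y in Ω, φ ‖y‖ * cutoff Ω g (u k) x y * f x := by
          refine setIntegral_congr_fun h.measurableSet fun x hx => ?_
          rw [h.opR_eq hx, integral_mul_const]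
      _ = ∫ y in Ω, ∫ x in Ω, φ ‖y‖ * cutoff Ω g (u k) x y * f x := integral_integral_swap hF
      _ = ∫ y in Ω, φ ‖y‖ * T y := by simp only [T, mul_assoc, integral_const_mul]
  have hT0 : ∀ y ∉ Ω, φ ‖y‖ * T y = 0 := fun y hy => by simp [T, hw.eq_zero _ y hy]
  have hTi : Integrable fun y => φ ‖y‖ * T y := by
    rw [← integrableOn_iff_integrable_of_support_subset (s := Ω)
      fun y hy => by_contra fun hn => hy (hT0 y hn)]
    have := hF.integral_prod_right
    simp only [mul_assoc, integral_const_mul] at this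
    exact this
  rw [h1, setIntegral_eq_integral_of_forall_compl_eq_zero hT0, integral_polar h.pos hTi,
    h.integral_rho]
  refine integral_congr_ae ?_
  filter_upwards [ae_pos_radialMeasure] with r hr
  rw [mul_left_comm, h.radialWeight_mul_inner_feature hr]
  simp only [norm_smul_sphere hr, integral_const_mul, T]
  congr 1
  have hswap : Integrable (fun p : Sp d × Metric.sphere (0 : Sp d) 1 =>
      cutoff Ω g (u k) p.1 (r • (p.2 : Sp d)) * f p.1)
      ((volume.restrict Ω).prod (sphereMeasure d)) :=
    (hfi.comp_fst _).bdd_mul (c := M) (h.integrable_sphere_prod hw r).1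
      (Eventually.of_forall fun p => hw.abs_le _ _)
  refine (integral_integral_swap hswap).symm.trans ?_
  simp only [sphereIntegral, integral_mul_const]

open ContinuousLinearMap in
theorem adjoint_ae_eq_opR {k : Fin N}
    {B : Lp ℝ 2 ((volume : Measure (Sp d)).restrict Ω) →L[ℝ] Lp ℝ 2 (rho Ω g u)}
    (hB : IsAnalysisOperator (rho Ω g u) (h.feature k) B) (φ : Lp ℝ 2 (rho Ω g u)) :
    adjoint B φ =ᵐ[volume.restrict Ω] opR Ω g φ (u k) := by
  have heq : (h.memLp_opR φ k).toLp _ = adjoint B φ := by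
    refine ext_inner_right ℝ fun f => ?_
    rw [adjoint_inner_left, hB.inner_eq, ← h.integral_opR_mul, L2.inner_def]
    refine integral_congr_ae ?_
    filter_upwards [(h.memLp_opR φ k).coeFn_toLp] with x hx
    rw [hx]
    simp [mul_comm]
  rw [← heq]
  exact (h.memLp_opR φ k).coeFn_toLp

end IsAdmissible

end Synthesis


/-! ### One-sided continuity and injectivity -/

section Injectivity

variable {d N : ℕ} {𝕏 : Type*} {Ω : Set (Sp d)} {g : 𝕏 → Sp d → Sp d → ℝ} {u : Fin N → 𝕏} {M : ℝ}

namespace IsAdmissible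

variable (h : IsAdmissible Ω g u M)
include h

theorem exists_norm_eq_of_radialWeight_pos {r : ℝ} (hr : 0 < r) (hw : 0 < radialWeight Ω g u r) :
    ∃ y ∈ Ω, ‖y‖ = r := by
  by_contra hne
  push Not at hne
  have : radialWeight Ω g u r = 0 := by
    simp [radialWeight, (h.isBoundedKernel _).abs.sphereIntegral_eq_zero hr hne]
  exact hw.ne' this

section Limits

variable {r : ℝ} {l : Filter ℝ} [l.IsCountablyGenerated] (hl : l ≤ 𝓝 r)
  (hbad : Tendsto (fun s : ℝ => sphereMeasure d {ξ | r • (ξ : Sp d) ∉ Ω ∧ s • (ξ : Sp d) ∈ Ω})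
    l (𝓝 0))
include hl hbad

theorem tendsto_radialWeight :
    Tendsto (radialWeight Ω g u) l (𝓝 (radialWeight Ω g u r)) := by
  have := h.isFiniteMeasure
  refine Tendsto.const_mul _ (tendsto_finsetSum _ fun k _ => ?_)
  have hw := (h.isBoundedKernel k).abs
  exact tendsto_integral_filter_of_dominated_convergence
    (fun _ => M * (sphereMeasure d).real Set.univ)
    (Eventually.of_forall fun s => (h.integrable_sphereIntegral hw s).1)
    (Eventually.of_forall fun s => Eventually.of_forall fun x => hw.abs_sphereIntegral_le s x)
    (integrable_const _)
    (Eventually.of_forall fun x => hw.tendsto_sphereIntegral h.isOpen hl hbad x)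

theorem tendsto_feature (hr : 0 < r) (hw : 0 < radialWeight Ω g u r) (k : Fin N) :
    Tendsto (h.feature k) l (𝓝 (h.feature k r)) := by
  have := h.isFiniteMeasure
  have hk := h.isBoundedKernel k
  have hwl := h.tendsto_radialWeight hl hbad
  set C := M * (sphereMeasure d).real Set.univ with hC
  have hC0 : 0 ≤ C := mul_nonneg h.nonneg measureReal_nonneg
  have hpos : ∀ᶠ s in l, 0 < s := hl (lt_mem_nhds hr)
  have hev : ∀ᶠ s in l, radialWeight Ω g u r / 2 < radialWeight Ω g u s :=
    hwl.eventually (lt_mem_nhds (half_lt_self hw))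
  have hb : ∀ s, 0 < s → radialWeight Ω g u r / 2 < radialWeight Ω g u s → ∀ x,
      |featureFun Ω g u k s x| ≤ C / (radialWeight Ω g u r / 2) := by
    intro s hs hs' x
    rw [featureFun, if_pos hs, abs_div, abs_of_nonneg (h.radialWeight_nonneg s)]
    exact div_le_div₀ hC0 (hk.abs_sphereIntegral_le s x) (half_pos hw) hs'.le
  have hnorm : ∀ s, ‖h.feature k s - h.feature k r‖ ^ 2 =
      ∫ x in Ω, (featureFun Ω g u k s x - featureFun Ω g u k r x) ^ 2 := by
    intro s
    rw [← real_inner_self_eq_norm_sq, L2.inner_def]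
    refine integral_congr_ae ?_
    filter_upwards [Lp.coeFn_sub (h.feature k s) (h.feature k r),
      (h.memLp_featureFun k s).coeFn_toLp, (h.memLp_featureFun k r).coeFn_toLp] with x h1 h2 h3
    rw [h1, Pi.sub_apply, feature, feature, h2, h3, real_inner_self_eq_norm_sq,
      Real.norm_eq_abs, sq_abs]
  have hlim : Tendsto (fun s => ‖h.feature k s - h.feature k r‖ ^ 2) l (𝓝 0) := by
    simp only [hnorm]
    rw [show (0 : ℝ) = ∫ x in Ω, (0 : ℝ) by simp]
    refine tendsto_integral_filter_of_dominated_convergence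
      (fun _ => (C / (radialWeight Ω g u r / 2) + C / (radialWeight Ω g u r / 2)) ^ 2)
      (Eventually.of_forall fun s =>
        ((h.memLp_featureFun k s).1.sub (h.memLp_featureFun k r).1).pow 2)
      ?_ (integrable_const _) (Eventually.of_forall fun x => ?_)
    · filter_upwards [hpos, hev] with s hs hs'
      refine Eventually.of_forall fun x => ?_
      rw [Real.norm_of_nonneg (sq_nonneg _), ← sq_abs]
      have h1 := hb s hs hs' x
      have h2 := hb r hr (half_lt_self hw) x
      have h3 := abs_sub (featureFun Ω g u k s x) (featureFun Ω g u k r x)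
      gcongr
      linarith
    · have h1 : Tendsto (fun s => featureFun Ω g u k s x) l (𝓝 (featureFun Ω g u k r x)) := by
        have h2 := (hk.tendsto_sphereIntegral h.isOpen hl hbad x).div hwl hw.ne'
        rw [featureFun, if_pos hr]
        refine h2.congr' ?_
        filter_upwards [hpos] with s hs
        rw [featureFun, if_pos hs, Pi.div_apply]
      simpa using (h1.sub_const (featureFun Ω g u k r x)).pow 2
  rw [tendsto_iff_norm_sub_tendsto_zero]
  simpa using hlim.sqrt

end Limits

section Kernel

variable {H : Type*} [NormedAddCommGroup H] [InnerProductSpace ℝ H] [CompleteSpace H]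
  [RKHS ℝ H ℝ ℝ] (hH : RKHS.kernel H = kerMatrix Ω g u)
include hH

theorem tendsto_kerSection {r : ℝ} {l : Filter ℝ} [l.IsCountablyGenerated] (hl : l ≤ 𝓝 r)
    (hbad : Tendsto (fun s : ℝ => sphereMeasure d {ξ | r • (ξ : Sp d) ∉ Ω ∧ s • (ξ : Sp d) ∈ Ω})
      l (𝓝 0)) (hr : 0 < r) (hw : 0 < radialWeight Ω g u r) :
    Tendsto (kerSection H) l (𝓝 (kerSection H r)) := by
  have hΦ := fun k => h.tendsto_feature hl hbad hr hw k
  have hG : ∀ {a b : ℝ → ℝ}, (∀ k, Tendsto (fun s => h.feature k (a s)) l (𝓝 (h.feature k r))) →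
      (∀ k, Tendsto (fun s => h.feature k (b s)) l (𝓝 (h.feature k r))) →
      Tendsto (fun s => ⟪kerSection H (a s), kerSection H (b s)⟫_ℝ) l
        (𝓝 ⟪kerSection H r, kerSection H r⟫_ℝ) := by
    intro a b ha hb
    simp only [inner_kerSection_kerSection hH, h.kerGbar_eq]
    exact (tendsto_finsetSum _ fun k _ => (ha k).inner (hb k)).const_mul _
  have h1 := hG (a := id) (b := id) hΦ hΦ
  have h2 := hG (a := id) (b := fun _ => r) hΦ fun k => tendsto_const_nhds
  have h3 : Tendsto (fun s => ‖kerSection H s - kerSection H r‖ ^ 2) l (𝓝 0) := by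
    have h4 := (h1.sub (h2.const_mul 2)).add_const ⟪kerSection H r, kerSection H r⟫_ℝ
    refine (h4.congr fun s => ?_).trans_eq ?_
    · rw [norm_sub_sq_real, real_inner_self_eq_norm_sq, id_eq, real_inner_self_eq_norm_sq]
    · congr 1
      ring
  rw [tendsto_iff_norm_sub_tendsto_zero]
  simpa using h3.sqrt

/-- A function of the reproducing kernel Hilbert space that vanishes `ρ`-almost everywhere is
zero: where `ρ` has positive density its value is a one-sided limit of zeros, and elsewhere the
kernel section is zero. -/
theorem eq_zero_of_ae_eq_zero (hΩr : RadiallyRegular Ω) {f : H} (hf : ∀ᵐ r ∂rho Ω g u, f r = 0) :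
    f = 0 := by
  have hf' : ∀ᵐ s, rhoDensity Ω g u s ≤ 0 ∨ f s = 0 := by
    rw [h.rho_eq_withDensity, ae_withDensity_iff'] at hf
    · filter_upwards [hf] with s hs
      by_cases h0 : rhoDensity Ω g u s ≤ 0
      · exact Or.inl h0
      · exact Or.inr (hs (ENNReal.ofReal_pos.2 (not_le.1 h0)).ne')
    · exact h.measurable_rhoDensity.ennreal_ofReal.aemeasurable
  have hdense := Measure.dense_of_ae hf'
  have key : ∀ {r : ℝ} {l : Filter ℝ} [l.IsCountablyGenerated], l ≤ 𝓝 r →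
      Tendsto (fun s : ℝ => sphereMeasure d {ξ | r • (ξ : Sp d) ∉ Ω ∧ s • (ξ : Sp d) ∈ Ω})
        l (𝓝 0) → 0 < r → 0 < radialWeight Ω g u r →
      (∃ᶠ s in l, rhoDensity Ω g u s ≤ 0 ∨ f s = 0) → f r = 0 := by
    intro r l _ hl hbad hr hw hfreq
    have hlim : Tendsto (fun s => f s) l (𝓝 (f r)) := by
      simp only [← inner_kerSection f]
      exact (h.tendsto_kerSection hH hl hbad hr hw).inner tendsto_const_nhds
    have hpos : ∀ᶠ s in l, 0 < rhoDensity Ω g u s := by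
      filter_upwards [hl (lt_mem_nhds hr), (h.tendsto_radialWeight hl hbad).eventually
        (lt_mem_nhds hw)] with s hs hs'
      exact (h.rhoDensity_pos_iff s).2 ⟨hs, hs'⟩
    exact isClosed_singleton.mem_of_frequently_of_tendsto
      ((hfreq.and_eventually hpos).mono fun s hs => hs.1.resolve_left (not_le.2 hs.2)) hlim
  refine RKHS.ext fun r => ?_
  rw [RKHS.coe_zero, Pi.zero_apply]
  by_cases hr : 0 < rhoDensity Ω g u r
  · obtain ⟨hr0, hw⟩ := (h.rhoDensity_pos_iff r).1 hr
    rcases hΩr r hr0 (h.exists_norm_eq_of_radialWeight_pos hr0 hw) with hb | hb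
    · refine key nhdsWithin_le_nhds hb hr0 hw (Filter.frequently_iff.2 fun {U} hU => ?_)
      obtain ⟨b, hb, hbU⟩ := mem_nhdsGT_iff_exists_Ioo_subset.1 hU
      obtain ⟨s, hs, hsr⟩ := hdense.exists_between hb
      exact ⟨s, hbU hsr, hs⟩
    · refine key nhdsWithin_le_nhds hb hr0 hw (Filter.frequently_iff.2 fun {U} hU => ?_)
      obtain ⟨b, hb, hbU⟩ := mem_nhdsLT_iff_exists_Ioo_subset.1 hU
      obtain ⟨s, hs, hsr⟩ := hdense.exists_between hb
      exact ⟨s, hbU hsr, hs⟩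
  · have h0 : ‖kerSection H r‖ ^ 2 = 0 := by
      rw [← real_inner_self_eq_norm_sq, inner_kerSection_kerSection hH, kerGbar,
        if_neg fun hc => hr hc.1]
    rw [← inner_kerSection, norm_eq_zero.1 ((pow_eq_zero_iff two_ne_zero).1 h0), inner_zero_left]

end Kernel

end IsAdmissible

end Injectivity


/-! ### The integral operator and the reproducing kernel Hilbert space -/

section IntegralOperator

variable {d N : ℕ} {𝕏 : Type*} {Ω : Set (Sp d)} {g : 𝕏 → Sp d → Sp d → ℝ} {u : Fin N → 𝕏} {M : ℝ}

namespace IsAdmissible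

variable (h : IsAdmissible Ω g u M)
include h

/-- The operator `Bₖ : L²(Ω) → L²(ρ)`, `(Bₖ f)(r) = ⟪Φₖ(r), f⟫`. -/
def analysisOp (k : Fin N) :
    Lp ℝ 2 ((volume : Measure (Sp d)).restrict Ω) →L[ℝ] Lp ℝ 2 (rho Ω g u) :=
  (h.exists_isAnalysisOperator_feature k).choose

theorem isAnalysisOperator_analysisOp (k : Fin N) :
    IsAnalysisOperator (rho Ω g u) (h.feature k) (h.analysisOp k) :=
  (h.exists_isAnalysisOperator_feature k).choose_spec

open ContinuousLinearMap

/-- The operator `(1/N) ∑ₖ Bₖ Bₖ†`, which is the integral operator with kernel `Ḡ`. -/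
def integralOp : Lp ℝ 2 (rho Ω g u) →L[ℝ] Lp ℝ 2 (rho Ω g u) :=
  (1 / (N : ℝ)) • ∑ k, h.analysisOp k ∘L adjoint (h.analysisOp k)

theorem isPositive_integralOp : h.integralOp.IsPositive :=
  (isPositive_sum _ fun k _ => isPositive_self_comp_adjoint (h.analysisOp k)).smul_of_nonneg
    (by positivity)

theorem isCompactOperator_integralOp : IsCompactOperator h.integralOp := by
  refine (compactOperator (RingHom.id ℝ) _ _).smul_mem _
    ((compactOperator (RingHom.id ℝ) _ _).sum_mem fun k _ => ?_)
  exact ((h.isAnalysisOperator_analysisOp k).isCompactOperator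
    (h.integrable_norm_feature_sq k)).comp_clm (adjoint (h.analysisOp k))

theorem inner_integralOp (φ ψ : Lp ℝ 2 (rho Ω g u)) :
    ⟪φ, h.integralOp ψ⟫_ℝ = (1 / (N : ℝ)) *
      ∑ k, ⟪adjoint (h.analysisOp k) φ, adjoint (h.analysisOp k) ψ⟫_ℝ := by
  simp [integralOp, inner_smul_right, inner_sum, adjoint_inner_left]

theorem integrable_mul_kerGbar (φ : Lp ℝ 2 (rho Ω g u)) (r : ℝ) :
    Integrable (fun s => φ s * kerGbar Ω g u r s) (rho Ω g u) := by
  simp only [h.kerGbar_eq, mul_left_comm (φ _), Finset.mul_sum]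
  refine integrable_finsetSum _ fun k _ => Integrable.const_mul ?_ _
  simp only [real_inner_comm _ (h.feature k r)]
  exact (h.isAnalysisOperator_analysisOp k).integrable_mul φ _

theorem integralOp_ae_eq (φ : Lp ℝ 2 (rho Ω g u)) :
    h.integralOp φ =ᵐ[rho Ω g u] fun r => ∫ s, φ s * kerGbar Ω g u r s ∂rho Ω g u := by
  have h1 : h.integralOp φ = (1 / (N : ℝ)) •
      ∑ k, (h.analysisOp k ∘L adjoint (h.analysisOp k)) φ := by
    simp [integralOp]
  have h2 : ∀ᵐ r ∂rho Ω g u, ∀ k, (h.analysisOp k ∘L adjoint (h.analysisOp k)) φ r =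
      ∫ s, φ s * ⟪h.feature k r, h.feature k s⟫_ℝ ∂rho Ω g u :=
    ae_all_iff.2 fun k => (h.isAnalysisOperator_analysisOp k).comp_adjoint_apply φ
  rw [h1]
  filter_upwards [h2, Lp.coeFn_smul (1 / (N : ℝ))
    (∑ k, (h.analysisOp k ∘L adjoint (h.analysisOp k)) φ),
    Lp.coeFn_finsetSum Finset.univ fun k => (h.analysisOp k ∘L adjoint (h.analysisOp k)) φ]
    with r hr hsmul hsum
  rw [hsmul, Pi.smul_apply, hsum, Finset.sum_apply, smul_eq_mul]
  simp only [hr, h.kerGbar_eq, mul_left_comm (φ _), Finset.mul_sum]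
  rw [integral_finsetSum]
  · simp only [integral_const_mul]
  · intro k _
    refine Integrable.const_mul ?_ _
    simp only [real_inner_comm _ (h.feature k r)]
    exact (h.isAnalysisOperator_analysisOp k).integrable_mul φ _

theorem bilin_eq_inner (φ ψ : Lp ℝ 2 (rho Ω g u)) :
    bilin Ω g u φ ψ = ⟪φ, h.integralOp ψ⟫_ℝ := by
  rw [h.inner_integralOp, bilin]
  congr 1
  refine Finset.sum_congr rfl fun k _ => ?_
  rw [L2.inner_def]
  refine integral_congr_ae ?_
  filter_upwards [h.adjoint_ae_eq_opR (h.isAnalysisOperator_analysisOp k) φ,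
    h.adjoint_ae_eq_opR (h.isAnalysisOperator_analysisOp k) ψ] with x h1 h2
  rw [h1, h2]
  simp [mul_comm]

theorem posSemidef_kerMatrix : (kerMatrix Ω g u).PosSemidef :=
  posSemidef_of_eq_sum_inner (c := 1 / (N : ℝ)) (by positivity) h.kerGbar_eq

section Kernel

variable {H : Type*} [NormedAddCommGroup H] [InnerProductSpace ℝ H] [CompleteSpace H]
  [RKHS ℝ H ℝ ℝ] (hH : RKHS.kernel H = kerMatrix Ω g u)
include hH

theorem exists_isAnalysisOperator_kerSection :
    ∃ ι, IsAnalysisOperator (rho Ω g u) (kerSection H) ι := by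
  refine exists_isAnalysisOperator (fun f => (measurable_inner_of_measurable_kernel
    (fun s => ?_) f).aestronglyMeasurable) ?_
  · simp only [inner_kerSection_kerSection hH, h.kerGbar_eq]
    exact (Finset.measurable_fun_sum _ fun k _ =>
      h.measurable_inner_feature_feature k s).const_mul _
  · simp only [← real_inner_self_eq_norm_sq, inner_kerSection_kerSection hH, h.kerGbar_eq]
    refine (integrable_finsetSum _ fun k _ => ?_).const_mul _
    simp only [real_inner_self_eq_norm_sq]
    exact h.integrable_norm_feature_sq k

theorem comp_adjoint_eq_integralOp {ι : H →L[ℝ] Lp ℝ 2 (rho Ω g u)}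
    (hι : IsAnalysisOperator (rho Ω g u) (kerSection H) ι) :
    ι ∘L adjoint ι = h.integralOp := by
  ext1 φ
  refine Lp.ext ?_
  filter_upwards [hι.comp_adjoint_apply φ, h.integralOp_ae_eq φ] with r h1 h2
  rw [h1, h2]
  simp only [inner_kerSection_kerSection hH]

end Kernel

end IsAdmissible

end IntegralOperator

end SIDA

end

theorem mainTheorem3 {d N : ℕ} (hd : 0 < d) {𝕏 : Type*}
    (Ω : Set (SIDA.Sp d)) (hΩo : IsOpen Ω) (hΩb : Bornology.IsBounded Ω)
    (hΩr : SIDA.RadiallyRegular Ω)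
    (g : 𝕏 → SIDA.Sp d → SIDA.Sp d → ℝ) (u : Fin N → 𝕏)
    (hgc : ∀ k, ContinuousOn (fun p : SIDA.Sp d × SIDA.Sp d => g (u k) p.1 p.2) (Ω ×ˢ Ω))
    (hgb : ∃ M : ℝ, ∀ k, ∀ x ∈ Ω, ∀ y ∈ Ω, |g (u k) x y| ≤ M)
    (hZ : 0 < SIDA.normConst Ω g u) :
    -- `ρ` is a probability measure with the stated density, the bilinear form makes sense on
    -- `L²(ρ)`, and `Ḡ` is positive semi-definite (so that it is the kernel of an RKHS)
    IsProbabilityMeasure (SIDA.rho Ω g u) ∧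
    SIDA.rho Ω g u = volume.withDensity (fun r => ENNReal.ofReal (SIDA.rhoDensity Ω g u r)) ∧
    (∀ (φ : Lp ℝ 2 (SIDA.rho Ω g u)) (k : Fin N),
      (∀ᵐ x ∂(volume.restrict Ω), IntegrableOn (fun y => φ ‖y‖ * g (u k) x y) Ω) ∧
      MemLp (SIDA.opR Ω g φ (u k)) 2 (volume.restrict Ω)) ∧
    (SIDA.kerMatrix Ω g u).PosSemidef ∧
    -- `L` is the integral operator with kernel `Ḡ`, and `S = L^{1/2}`
    ∃ L S : Lp ℝ 2 (SIDA.rho Ω g u) →L[ℝ] Lp ℝ 2 (SIDA.rho Ω g u),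
      SIDA.IsIntegralOperator (SIDA.rho Ω g u) (SIDA.kerGbar Ω g u) L ∧
      SIDA.IsPosSqrt S L ∧
      -- (b), first part: an orthonormal basis of eigenfunctions exists, and for each one the
      -- eigenvalues tend to zero and the first two identities hold
      (∃ (n : ℕ∞) (J : Type), Nonempty (SIDA.EigenSystem L n J)) ∧
      (∀ (n : ℕ∞) (J : Type) (e : SIDA.EigenSystem L n J),
        Tendsto e.eig cofinite (𝓝 0) ∧
        ∀ φ : Lp ℝ 2 (SIDA.rho Ω g u),
          HasSum (fun i => e.eig i * e.basis.repr φ (Sum.inl i) ^ 2) (SIDA.bilin Ω g u φ φ) ∧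
          HasSum (fun m => e.basis.repr φ m ^ 2) (‖φ‖ ^ 2)) ∧
      -- `H` is the RKHS with reproducing kernel `Ḡ`; `ι` sends a function in `H` to its class
      -- in `L²(ρ)`
      ∀ (H : Type*) [NormedAddCommGroup H] [InnerProductSpace ℝ H] [CompleteSpace H]
        [RKHS ℝ H ℝ ℝ], RKHS.kernel H = SIDA.kerMatrix Ω g u →
        ∃ ι : H →L[ℝ] Lp ℝ 2 (SIDA.rho Ω g u),
          (∀ f : H, ι f =ᵐ[SIDA.rho Ω g u] f) ∧
          Function.Injective ι ∧
          -- (a)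
          Set.range ι = Set.range S ∧
          (∀ f h : H, ⟪f, h⟫_ℝ = ⟪SIDA.pinv S (ι f), SIDA.pinv S (ι h)⟫_ℝ) ∧
          -- (b), third identity
          (∀ (n : ℕ∞) (J : Type) (e : SIDA.EigenSystem L n J) (f : H),
            (∀ j, e.basis.repr (ι f) (Sum.inr j) = 0) ∧
            HasSum (fun i => (e.eig i)⁻¹ * e.basis.repr (ι f) (Sum.inl i) ^ 2) (‖f‖ ^ 2)) ∧
          -- (c): `h₁` is `L φ` and `h₂` is `L² φ`, as elements of `H`
          (∀ φ : Lp ℝ 2 (SIDA.rho Ω g u), ∃ h₁ h₂ : H, ι h₁ = L φ ∧ ι h₂ = L (L φ) ∧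
            ∀ ψ : H, ⟪φ, ι ψ⟫_ℝ = ⟪h₁, ψ⟫_ℝ ∧ SIDA.bilin Ω g u φ ψ = ⟪h₂, ψ⟫_ℝ) := by
  obtain ⟨M, hM⟩ := hgb
  have h : SIDA.IsAdmissible Ω g u |M| :=
    ⟨hd, hΩo, hΩb, hgc, fun k x hx y hy => (hM k x hx y hy).trans (le_abs_self M), abs_nonneg M, hZ⟩
  obtain ⟨n, J, ⟨e⟩⟩ := SIDA.exists_eigenSystem h.isCompactOperator_integralOp
    h.isPositive_integralOp
  obtain ⟨S, hS⟩ := e.exists_isPosSqrt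
  refine ⟨h.isProbabilityMeasure_rho, h.rho_eq_withDensity,
    fun φ k => ⟨h.ae_integrableOn φ k, h.memLp_opR φ k⟩, h.posSemidef_kerMatrix,
    h.integralOp, S, fun φ => ?_, hS, ⟨n, J, ⟨e⟩⟩, fun n J e => ⟨?_, fun φ => ⟨?_, ?_⟩⟩, ?_⟩
  · filter_upwards [h.integralOp_ae_eq φ] with r hr
    exact ⟨h.integrable_mul_kerGbar φ r, hr⟩
  · exact e.tendsto_eig h.isCompactOperator_integralOp
  · rw [h.bilin_eq_inner]
    exact e.hasSum_eig_mul_repr_sq h.isPositive_integralOp.isSymmetric φ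
  · exact e.hasSum_repr_sq φ
  intro H _ _ _ _ hH
  obtain ⟨ι, hι⟩ := h.exists_isAnalysisOperator_kerSection hH
  have hιL := h.comp_adjoint_eq_integralOp hH hι
  have hcoe : ∀ f : H, ι f =ᵐ[SIDA.rho Ω g u] f := fun f => by
    filter_upwards [hι f] with r hr
    rw [hr, SIDA.inner_kerSection]
  have hinj : Function.Injective ι := by
    refine (injective_iff_map_eq_zero ι).2 fun f hf => h.eq_zero_of_ae_eq_zero hH hΩr ?_
    filter_upwards [hcoe f, Lp.coeFn_zero ℝ 2 (SIDA.rho Ω g u)] with r h1 h2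
    rw [← h1, hf, h2, Pi.zero_apply]
  refine ⟨ι, hcoe, hinj, SIDA.range_eq_of_comp_adjoint_eq hS hιL hinj,
    SIDA.inner_eq_inner_pinv hS hιL hinj, fun n J e f =>
    ⟨e.repr_inr_eq_zero hιL f, e.hasSum_inv_eig_mul_repr_sq hιL hinj f⟩, fun φ =>
    ⟨ContinuousLinearMap.adjoint ι φ, ContinuousLinearMap.adjoint ι (h.integralOp φ),
      congrArg (· φ) hιL, congrArg (· (h.integralOp φ)) hιL, fun ψ => ⟨?_, ?_⟩⟩⟩
  · rw [ContinuousLinearMap.adjoint_inner_left]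
  · have hsymm := h.isPositive_integralOp.inner_left_eq_inner_right φ (ι ψ)
    rw [ContinuousLinearMap.adjoint_inner_left, hsymm, ← h.bilin_eq_inner]
    exact h.bilin_congr (ae_eq_refl _) (hcoe ψ).symm
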